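/- Let $\mathcal S=\{S_1,\dots,S_m\}$ be a finite system of nondegenerate (invertible) contracting affine maps of the Euclidean plane $\mathbb R^2$, and suppose that its attractor, i.e. the unique nonempty compact set $\gamma$ with $\gamma=\bigcup_{i=1}^m S_i(\gamma)$, is a Jordan arc (a homeomorphic image of $[0,1]$). Say that two Jordan arcs $\gamma_1,\gamma_2$ intersect properly if $\gamma_1\cap\gamma_2$ is a nondegenerate subarc of $\gamma_1$ and of $\gamma_2$, one endpoint of which is an endpoint of $\gamma_1$ and the other endpoint of which is an endpoint of $\gamma_2$. For $\delta>0$ let $A_\delta(\gamma)$ be the set of all subarcs $\alpha=h(\gamma)\cap\gamma$ of diameter at least $\delta$, where $h$ is an affine map of $\mathbb R^2$ such that $h(\gamma)$ is a Jordan arc and $h(\gamma)$ and $\gamma$ intersect properly. If, for some $\delta>0$, the set $A_\delta(\gamma)$ is infinite, then $\gamma$ is a segment (nondegenerate subarc) of a parabola or of a straight line. -/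

import Mathlib

open Set

/-- The Euclidean plane. -/
abbrev Plane : Type := EuclideanSpace ℝ (Fin 2)

/-- `γ` is a Jordan arc with endpoints `x` and `y`: the image of an injective path from `x`
to `y`. In particular such an arc is nondegenerate (it is not a single point). -/
def IsJordanArcBetween (γ : Set Plane) (x y : Plane) : Prop :=
  ∃ p : Path x y, Function.Injective p ∧ range p = γ

/-- `γ` is a Jordan arc. -/
def IsJordanArc (γ : Set Plane) : Prop :=
  ∃ x y, IsJordanArcBetween γ x y

/-- `γ` is a Jordan arc and `x` is one of its two endpoints. -/
def IsEndpoint (x : Plane) (γ : Set Plane) : Prop :=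
  ∃ y, IsJordanArcBetween γ x y

/-- A nonempty compact set `K` that is the union of its images under the maps `S i`. -/
def IsAttractor {m : ℕ} (S : Fin m → Plane →ᵃ[ℝ] Plane) (K : Set Plane) : Prop :=
  K.Nonempty ∧ IsCompact K ∧ K = ⋃ i, S i '' K

/-- Two Jordan arcs intersect properly: their intersection is a (nondegenerate) arc one of whose
endpoints is an endpoint of `γ₁`, and whose other endpoint is an endpoint of `γ₂`. -/
def ProperIntersection (γ₁ γ₂ : Set Plane) : Prop :=
  ∃ x y, IsJordanArcBetween (γ₁ ∩ γ₂) x y ∧ IsEndpoint x γ₁ ∧ IsEndpoint y γ₂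

/-- The set of subarcs `h(γ) ∩ γ` of diameter at least `δ`, where `h` is an affine map such that
`h(γ)` and `γ` are Jordan arcs that intersect properly. -/
def properSubarcs (γ : Set Plane) (δ : ℝ) : Set (Set Plane) :=
  {α | ∃ h : Plane →ᵃ[ℝ] Plane,
    ProperIntersection (h '' γ) γ ∧ α = h '' γ ∩ γ ∧ δ ≤ Metric.diam α}

/-- A nondegenerate segment (subarc) of a parabola; parabolas are the curves
`t ↦ p + t u + t² v` with `u`, `v` linearly independent. -/
def IsParabolaSegment (γ : Set Plane) : Prop :=
  ∃ (p u v : Plane) (a b : ℝ), LinearIndependent ℝ ![u, v] ∧ a < b ∧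
    γ = (fun t : ℝ => p + t • u + t ^ 2 • v) '' Icc a b

/-- A nondegenerate segment of a straight line. -/
def IsStraightSegment (γ : Set Plane) : Prop :=
  ∃ p q : Plane, p ≠ q ∧ γ = segment ℝ p q

/-! If `γ` lies in a line, it is a compact connected set on a line, hence a segment. Otherwise
infinitely many subarcs produce an infinitesimal affine symmetry of `γ`, which makes `γ` an orbit
arc of an affine vector field. The contractions of the system then single out the parabola.

Near-identity maps (`exists_near_identity`): precomposing each `h` with a piece map keeps `α = h(γ)
∩ γ` and gives `h(S i (γ)) ⊆ α` for some `i`. By pigeonhole, infinitely many arcs share the index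
`j` and an endpoint `q` of `γ`. These `h` and their inverses are bounded, so two of them are
arbitrarily close. Arcs through `q` are nested, so when `α₁ ⊆ α₂` the map `h₂⁻¹ ∘ h₁` is close to
the identity, different from it, and carries `S j (γ)` into `γ`.

Orbit (`exists_orbit_subset`, `exists_orbit_param`): rescaled displacements of such maps subconverge
to a nonzero affine field, and their iterates converge to its flow, so `γ` contains an orbit arc.
That arc contains an affine copy of `γ`, so `γ` itself is an orbit arc of an affine field with
linear part `M`.

Parabola (`isParabolaSegment_of_self_map`): a contraction of the system maps this arc into a proper
part of itself, which gives a time change with `φ' ^ 2 ≠ 1` somewhere. Comparing derivatives forces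
`9 det M = 2 (tr M) ^ 2`, so the eigenvalues of `M` are `μ` and `2 μ`, and a non-flat orbit of such
a field is a parabola. -/

/-! ### Endpoints of arcs through nested connected subsets -/

/-- Any two connected subsets of `γ` through `a` are nested. -/
def NestedAt (γ : Set Plane) (a : Plane) : Prop :=
  ∀ A B : Set Plane, A ⊆ γ → B ⊆ γ → IsPreconnected A → IsPreconnected B → a ∈ A → a ∈ B →
    A ⊆ B ∨ B ⊆ A

theorem IsPreconnected.preimage_path {x y : Plane} {p : Path x y} (hp : Function.Injective p)
    {A : Set Plane} (hA : IsPreconnected A) (hsub : A ⊆ range p) : IsPreconnected (p ⁻¹' A) := by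
  have hemb : Topology.IsEmbedding p :=
    (p.continuous.isClosedEmbedding hp).isEmbedding
  rw [← hemb.isInducing.isPreconnected_image, image_preimage_eq_of_subset hsub]
  exact hA

theorem nested_of_preconnected_of_zero_mem {s t : Set unitInterval} (hs : IsPreconnected s)
    (ht : IsPreconnected t) (h0s : 0 ∈ s) (h0t : 0 ∈ t) : s ⊆ t ∨ t ⊆ s := by
  by_contra! h
  obtain ⟨h1, h2⟩ := h
  obtain ⟨u, hus, hut⟩ := not_subset.1 h1
  obtain ⟨v, hvt, hvs⟩ := not_subset.1 h2
  rcases le_total u v with huv | huv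
  · exact hut (ht.ordConnected.out h0t hvt ⟨unitInterval.nonneg', huv⟩)
  · exact hvs (hs.ordConnected.out h0s hus ⟨unitInterval.nonneg', huv⟩)

theorem IsEndpoint.nestedAt {γ : Set Plane} {a : Plane} (h : IsEndpoint a γ) : NestedAt γ a := by
  obtain ⟨y, p, hp, rfl⟩ := h
  intro A B hA hB cA cB haA haB
  have key := nested_of_preconnected_of_zero_mem (cA.preimage_path hp hA)
    (cB.preimage_path hp hB) (by simpa using haA) (by simpa using haB)
  have e : ∀ {C : Set Plane}, C ⊆ range p → p '' (p ⁻¹' C) = C :=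
    fun hC => image_preimage_eq_of_subset hC
  rcases key with h | h
  · left; rw [← e hA, ← e hB]; exact image_mono h
  · right; rw [← e hA, ← e hB]; exact image_mono h

/-- The two subarcs into which an interior point cuts the arc both contain it and are not nested.
This leaves only two candidates in the later pigeonhole argument. -/
theorem NestedAt.eq_or_eq {x y a : Plane} {p : Path x y} (hp : Function.Injective p)
    (h : NestedAt (range p) a) (ha : a ∈ range p) : a = x ∨ a = y := by
  obtain ⟨t, rfl⟩ := ha
  have h1 : IsPreconnected (p '' Icc 0 t) := isPreconnected_Icc.image _ p.continuous.continuousOn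
  have h2 : IsPreconnected (p '' Icc t 1) := isPreconnected_Icc.image _ p.continuous.continuousOn
  rcases h _ _ (image_subset_range _ _) (image_subset_range _ _) h1 h2
    (mem_image_of_mem _ ⟨unitInterval.nonneg', le_rfl⟩)
    (mem_image_of_mem _ ⟨le_rfl, unitInterval.le_one'⟩) with h | h
  · left
    have := h (mem_image_of_mem p ⟨le_rfl, unitInterval.nonneg'⟩)
    obtain ⟨s, hs, hs'⟩ := this
    have : t = 0 := le_antisymm (by rw [← hp hs']; exact hs.1) unitInterval.nonneg'
    simp [this]
  · right
    have := h (mem_image_of_mem p ⟨unitInterval.le_one', le_rfl⟩)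
    obtain ⟨s, hs, hs'⟩ := this
    have : t = 1 := le_antisymm unitInterval.le_one' (by rw [← hp hs']; exact hs.2)
    simp [this]

theorem NestedAt.of_image {γ : Set Plane} {a : Plane} (e : Plane ≃ᵃ[ℝ] Plane)
    (h : NestedAt (e '' γ) (e a)) : NestedAt γ a := by
  have hc : Continuous e := (e : Plane →ᵃ[ℝ] Plane).continuous_of_finiteDimensional
  intro A B hA hB cA cB haA haB
  have := h _ _ (image_mono hA) (image_mono hB) (cA.image _ hc.continuousOn)
    (cB.image _ hc.continuousOn) (mem_image_of_mem _ haA) (mem_image_of_mem _ haB)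
  simpa only [image_subset_image_iff e.injective] using this

/-! ### Small affine copies of the attractor inside itself -/

section Pieces

variable {m : ℕ} {S : Fin m → Plane ≃ᵃ[ℝ] Plane} {K : NNReal} {γ : Set Plane}

theorem diam_image_le {T : Plane → Plane} (hγ : IsCompact γ) {C : NNReal}
    (hT : LipschitzWith C T) : Metric.diam (T '' γ) ≤ C * Metric.diam γ := by
  refine Metric.diam_le_of_forall_dist_le (by positivity) ?_
  rintro _ ⟨u, hu, rfl⟩ _ ⟨v, hv, rfl⟩
  exact (hT.dist_le_mul u v).trans
    (mul_le_mul_of_nonneg_left (Metric.dist_le_diam_of_mem hγ.isBounded hu hv) C.2)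

theorem exists_pow_mul_lt (hK1 : K < 1) (d : ℝ) {ε : ℝ} (hε : 0 < ε) :
    ∃ n : ℕ, (K : ℝ) ^ n * d < ε := by
  have h : Filter.Tendsto (fun n : ℕ => (K : ℝ) ^ n * d) Filter.atTop (nhds (0 * d)) :=
    (tendsto_pow_atTop_nhds_zero_of_lt_one K.2 (by exact_mod_cast hK1)).mul_const d
  rw [zero_mul] at h
  exact (h.eventually (gt_mem_nhds hε)).exists

theorem exists_small_piece (hS : γ = ⋃ i, S i '' γ) (hK : ∀ i, LipschitzWith K (S i))
    (hK1 : K < 1) (hγ : IsCompact γ) {x : Plane} (hx : x ∈ γ) {ε : ℝ} (hε : 0 < ε) :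
    ∃ T : Plane ≃ᵃ[ℝ] Plane, T '' γ ⊆ γ ∧ x ∈ T '' γ ∧ Metric.diam (T '' γ) < ε := by
  have key : ∀ n : ℕ, ∃ T : Plane ≃ᵃ[ℝ] Plane, T '' γ ⊆ γ ∧ x ∈ T '' γ ∧
      LipschitzWith (K ^ n) T := by
    intro n
    induction n with
    | zero =>
      refine ⟨AffineEquiv.refl ℝ Plane, by simp, by simpa using hx, ?_⟩
      simpa using LipschitzWith.id
    | succ n ih =>
      obtain ⟨T, h1, ⟨z, hz, rfl⟩, h3⟩ := ih
      rw [hS] at hz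
      obtain ⟨i, w, hw, rfl⟩ := mem_iUnion.1 hz
      refine ⟨(S i).trans T, ?_, ⟨w, hw, rfl⟩, ?_⟩
      · rintro _ ⟨u, hu, rfl⟩
        refine h1 ⟨S i u, ?_, rfl⟩
        rw [hS]
        exact mem_iUnion.2 ⟨i, u, hu, rfl⟩
      · rw [pow_succ]
        exact h3.comp (hK i)
  obtain ⟨n, hn⟩ := exists_pow_mul_lt hK1 (Metric.diam γ) hε
  obtain ⟨T, h1, h2, h3⟩ := key n
  refine ⟨T, h1, h2, (diam_image_le hγ h3).trans_lt ?_⟩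
  simpa using hn

/-- An interior point of the subarc `D` has positive distance to the rest of `γ`, and a small enough
piece through it stays well inside. The margin `r` is the room in which near-identity maps are
iterated later. -/
theorem exists_piece_subset (hS : γ = ⋃ i, S i '' γ) (hK : ∀ i, LipschitzWith K (S i))
    (hK1 : K < 1) (harc : IsJordanArc γ) (hγ : IsCompact γ) {D : Set Plane} (hD : D ⊆ γ)
    (cD : IsPreconnected D) (nD : D.Nontrivial) :
    ∃ (T : Plane ≃ᵃ[ℝ] Plane) (r : ℝ), 0 < r ∧ T '' γ ⊆ D ∧ T '' γ ⊆ γ ∧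
      ∀ x ∈ T '' γ, ∀ z ∈ γ, dist z x < r → z ∈ D := by
  obtain ⟨a, b, p, hp, hr⟩ := harc
  obtain ⟨u, v, hu, hv, huv⟩ : ∃ u v, u ∈ p ⁻¹' D ∧ v ∈ p ⁻¹' D ∧ u < v := by
    obtain ⟨y, hy, z, hz, hyz⟩ := nD
    obtain ⟨u, rfl⟩ : y ∈ range p := hr ▸ hD hy
    obtain ⟨v, rfl⟩ : z ∈ range p := hr ▸ hD hz
    rcases lt_trichotomy u v with h | h | h
    · exact ⟨u, v, hy, hz, h⟩
    · exact absurd (by rw [h]) hyz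
    · exact ⟨v, u, hz, hy, h⟩
  have hsub : Icc u v ⊆ p ⁻¹' D :=
    (cD.preimage_path hp (hr ▸ hD)).ordConnected.out hu hv
  obtain ⟨t, ht⟩ := exists_between huv
  have hF : IsClosed (p '' (Ioo u v)ᶜ) :=
    (isOpen_Ioo.isClosed_compl.isCompact.image p.continuous).isClosed
  have hxF : p t ∉ p '' (Ioo u v)ᶜ := by
    rintro ⟨s, hs, hst⟩
    exact hs (hp hst ▸ ht)
  obtain ⟨ρ, hρ, hball⟩ := Metric.isOpen_iff.1 hF.isOpen_compl _ hxF
  have hmem : ∀ z ∈ γ, dist z (p t) < ρ → z ∈ D := by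
    intro z hz hd
    rw [← hr] at hz
    obtain ⟨s, rfl⟩ := hz
    by_contra hcon
    refine hball (Metric.mem_ball.2 hd) ⟨s, fun hs => hcon (hsub (Ioo_subset_Icc_self hs)), rfl⟩
  obtain ⟨T, h1, h2, h3⟩ := exists_small_piece hS hK hK1 hγ
    (hD (hsub (Ioo_subset_Icc_self ht))) (half_pos hρ)
  have hb : Bornology.IsBounded (T '' γ) := hγ.isBounded.subset h1
  have hd : ∀ x ∈ T '' γ, dist x (p t) < ρ / 2 := fun x hx =>
    (Metric.dist_le_diam_of_mem hb hx h2).trans_lt h3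
  have hlast : ∀ x ∈ T '' γ, ∀ z ∈ γ, dist z x < ρ / 2 → z ∈ D := by
    intro x hx z hz hzx
    refine hmem z hz ?_
    linarith [dist_triangle z x (p t), hd x hx]
  exact ⟨T, ρ / 2, half_pos hρ, fun x hx => hlast x hx x (h1 hx) (by simpa using half_pos hρ),
    h1, hlast⟩

/-- Descend through pieces containing `a`. Nestedness makes each next piece either lie in `β`, which
ends the search, or contain `β`; the latter cannot continue forever because the diameters tend to
zero. -/
theorem exists_piece_comparable (hS : γ = ⋃ i, S i '' γ) (hK : ∀ i, LipschitzWith K (S i))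
    (hK1 : K < 1) (hγ : IsCompact γ) (cγ : IsPreconnected γ) {β : Set Plane} (hβ : β ⊆ γ)
    (cβ : IsPreconnected β) (dβ : 0 < Metric.diam β) {a : Plane} (ha : a ∈ β)
    (hn : NestedAt γ a) :
    ∃ (T : Plane ≃ᵃ[ℝ] Plane) (i : Fin m), T '' γ ⊆ γ ∧ β ⊆ T '' γ ∧ T '' (S i '' γ) ⊆ β := by
  by_contra! hcon
  have key : ∀ n : ℕ, ∃ T : Plane ≃ᵃ[ℝ] Plane, T '' γ ⊆ γ ∧ β ⊆ T '' γ ∧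
      LipschitzWith (K ^ n) T := by
    intro n
    induction n with
    | zero =>
      refine ⟨AffineEquiv.refl ℝ Plane, by simp, by simpa using hβ, ?_⟩
      simpa using LipschitzWith.id
    | succ n ih =>
      obtain ⟨T, h1, h2, h3⟩ := ih
      obtain ⟨z, hz, hza⟩ := h2 ha
      rw [hS] at hz
      obtain ⟨i, w, hw, rfl⟩ := mem_iUnion.1 hz
      have hsub : S i '' γ ⊆ γ := by
        conv_rhs => rw [hS]
        exact subset_iUnion (fun i => S i '' γ) i
      have hTS : T '' (S i '' γ) ⊆ γ := (image_mono hsub).trans h1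
      have hc : IsPreconnected (T '' (S i '' γ)) :=
        (cγ.image _ (hK i).continuous.continuousOn).image _ h3.continuous.continuousOn
      have hle : β ⊆ T '' (S i '' γ) :=
        (hn _ _ hTS hβ hc cβ ⟨_, ⟨w, hw, rfl⟩, hza⟩ ha).resolve_left (hcon T i h1 h2)
      have he : (S i).trans T '' γ = T '' (S i '' γ) := by
        rw [image_image]; rfl
      refine ⟨(S i).trans T, he ▸ hTS, he ▸ hle, ?_⟩
      rw [pow_succ]
      exact h3.comp (hK i)
  obtain ⟨n, hn⟩ := exists_pow_mul_lt hK1 (Metric.diam γ) dβ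
  obtain ⟨T, h1, h2, h3⟩ := key n
  have := (Metric.diam_mono h2 (hγ.isBounded.subset h1)).trans (diam_image_le hγ h3)
  push_cast at this
  linarith

end Pieces

/-! ### Flat sets and homogeneous coordinates -/

/-- `K` is contained in a line. -/
def IsFlat (K : Set Plane) : Prop :=
  ∃ (l : Plane →ₗ[ℝ] ℝ) (c : ℝ), l ≠ 0 ∧ ∀ x ∈ K, l x = c

theorem IsFlat.mono {K L : Set Plane} (h : IsFlat L) (hKL : K ⊆ L) : IsFlat K := by
  obtain ⟨l, c, hl, h⟩ := h
  exact ⟨l, c, hl, fun x hx => h x (hKL hx)⟩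

theorem IsFlat.of_image {K : Set Plane} (e : Plane ≃ᵃ[ℝ] Plane) (h : IsFlat (e '' K)) :
    IsFlat K := by
  obtain ⟨l, c, hl, h⟩ := h
  refine ⟨l.comp e.linear.toLinearMap, c - l (e 0), ?_, ?_⟩
  · intro h0
    apply hl
    ext v
    have := LinearMap.congr_fun h0 (e.linear.symm v)
    simpa using this
  · intro x hx
    have h1 := h _ (mem_image_of_mem _ hx)
    have h2 : e x = e.linear x + e 0 := by
      have := (e : Plane →ᵃ[ℝ] Plane).map_vadd 0 x
      simpa using this
    rw [h2, map_add] at h1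
    simp only [LinearMap.coe_comp, Function.comp_apply, LinearEquiv.coe_coe]
    linarith

theorem IsFlat.image_of_not_bijective {f : Plane →ᵃ[ℝ] Plane} (hf : ¬ Function.Bijective f)
    (K : Set Plane) : IsFlat (f '' K) := by
  have hs : ¬ Function.Surjective f.linear := by
    intro hs
    have hi : Function.Injective f.linear := LinearMap.injective_iff_surjective.2 hs
    exact hf ⟨f.linear_injective_iff.1 hi, f.linear_surjective_iff.1 hs⟩
  have hr : LinearMap.range f.linear < ⊤ :=
    lt_top_iff_ne_top.2 fun h => hs (LinearMap.range_eq_top.1 h)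
  obtain ⟨l, hl, hle⟩ := Submodule.exists_le_ker_of_lt_top _ hr
  refine ⟨l, l (f 0), hl, ?_⟩
  rintro _ ⟨x, -, rfl⟩
  have h2 : f x = f.linear x + f 0 := by
    have := f.map_vadd 0 x
    simpa using this
  have h3 : l (f.linear x) = 0 := hle ⟨x, rfl⟩
  rw [h2, map_add, h3, zero_add]

/-- A nonzero functional on `Plane × ℝ` that vanishes at all `(x, 1)` with `x ∈ K` is the equation
of a line containing `K`. -/
theorem span_eq_top_of_not_isFlat {K : Set Plane} (hne : K.Nonempty) (hK : ¬ IsFlat K) :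
    Submodule.span ℝ ((fun x : Plane => ((x, 1) : Plane × ℝ)) '' K) = ⊤ := by
  by_contra hcon
  obtain ⟨f, hf, hle⟩ := Submodule.exists_le_ker_of_lt_top _ (lt_top_iff_ne_top.2 hcon)
  have h1 : ∀ x ∈ K, f (x, 0) + f (0, 1) = 0 := by
    intro x hx
    have : f (x, 1) = 0 := hle (Submodule.subset_span ⟨x, hx, rfl⟩)
    rw [← map_add]
    simpa using this
  apply hK
  refine ⟨f.comp (LinearMap.inl ℝ Plane ℝ), -f (0, 1), ?_, ?_⟩
  · intro h0
    have h2 : ∀ x, f (x, 0) = 0 := fun x => LinearMap.congr_fun h0 x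
    obtain ⟨x, hx⟩ := hne
    have h3 : f (0, 1) = 0 := by simpa [h2] using h1 x hx
    apply hf
    ext v
    · simpa using h2 _
    · simpa using h3
  · intro x hx
    have := h1 x hx
    simp only [LinearMap.coe_comp, Function.comp_apply, LinearMap.inl_apply]
    linarith

/-- On the endomorphisms of `Plane × ℝ` the evaluations at the points of a non-flat set control
the norm. -/
theorem exists_norm_le_of_not_isFlat {K : Set Plane} (hne : K.Nonempty) (hK : ¬ IsFlat K) :
    ∃ C : ℝ, 0 < C ∧ ∀ (B : (Plane × ℝ) →L[ℝ] (Plane × ℝ)) (R : ℝ), 0 ≤ R →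
      (∀ x ∈ K, ‖B (x, 1)‖ ≤ R) → ‖B‖ ≤ C * R := by
  obtain ⟨b, hb, hspan, hlin⟩ := exists_linearIndependent ℝ
    ((fun x : Plane => ((x, 1) : Plane × ℝ)) '' K)
  rw [span_eq_top_of_not_isFlat hne hK] at hspan
  have : Finite b := hlin.finite
  have : Fintype b := Fintype.ofFinite b
  let Φ : ((Plane × ℝ) →L[ℝ] (Plane × ℝ)) →ₗ[ℝ] (b → Plane × ℝ) :=
    { toFun := fun B v => B v
      map_add' := fun _ _ => rfl
      map_smul' := fun _ _ => rfl }
  have hΦ : LinearMap.ker Φ = ⊥ := by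
    rw [LinearMap.ker_eq_bot']
    intro B hB
    apply ContinuousLinearMap.coe_injective
    refine LinearMap.ext_on_range (v := ((↑) : b → Plane × ℝ)) ?_ fun v => congr_fun hB v
    rw [Subtype.range_coe, hspan]
  obtain ⟨C, hC, hanti⟩ := Φ.exists_antilipschitzWith hΦ
  refine ⟨C, by exact_mod_cast hC, fun B R hR hB => ?_⟩
  have h1 : ‖B‖ ≤ C * ‖Φ B‖ := by
    have := hanti.le_mul_dist B 0
    simpa using this
  refine h1.trans (mul_le_mul_of_nonneg_left ?_ C.2)
  refine (pi_norm_le_iff_of_nonneg hR).2 fun v => ?_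
  obtain ⟨x, hx, hxv⟩ := hb v.2
  have := hB x hx
  change ‖B v‖ ≤ R
  rw [← hxv]
  exact this

/-- The linear map of `Plane × ℝ` that describes `f` in homogeneous coordinates. -/
noncomputable def homog (f : Plane →ᵃ[ℝ] Plane) : (Plane × ℝ) →L[ℝ] (Plane × ℝ) :=
  LinearMap.toContinuousLinearMap
    (((f.linear.comp (LinearMap.fst ℝ Plane ℝ)) +
      (LinearMap.toSpanSingleton ℝ Plane (f 0)).comp (LinearMap.snd ℝ Plane ℝ)).prod
      (LinearMap.snd ℝ Plane ℝ))

theorem homog_apply (f : Plane →ᵃ[ℝ] Plane) (v : Plane × ℝ) :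
    homog f v = (f.linear v.1 + v.2 • f 0, v.2) := rfl

theorem homog_apply_one (f : Plane →ᵃ[ℝ] Plane) (x : Plane) : homog f (x, 1) = (f x, 1) := by
  rw [homog_apply]
  have := f.map_vadd 0 x
  simp only [vadd_eq_add, add_zero] at this
  simp [this]

theorem homog_injective : Function.Injective homog := by
  intro f g h
  ext1 x
  have := homog_apply_one f x
  rw [h, homog_apply_one] at this
  exact (congr_arg Prod.fst this).symm

theorem homog_comp (f g : Plane →ᵃ[ℝ] Plane) : homog (f.comp g) = homog f * homog g := by
  refine ContinuousLinearMap.ext fun v => ?_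
  have h2 : f (g 0) = f.linear (g 0) + f 0 := by
    have := f.map_vadd 0 (g 0)
    simpa using this
  simp [homog_apply, h2, add_assoc]

theorem homog_id : homog (AffineMap.id ℝ Plane) = 1 := by
  refine ContinuousLinearMap.ext fun v => ?_
  simp [homog_apply]

/-! ### From near-identity affine maps to a flow -/

theorem exists_close_pair {ι : Type*} {E : Type*} [NormedAddCommGroup E] [NormedSpace ℝ E]
    [FiniteDimensional ℝ E] {s : Set ι} (hs : s.Infinite) {f : ι → E} {R : ℝ}
    (hR : ∀ i ∈ s, ‖f i‖ ≤ R) {ε : ℝ} (hε : 0 < ε) :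
    ∃ i ∈ s, ∃ j ∈ s, i ≠ j ∧ ‖f i - f j‖ < ε := by
  have : ProperSpace E := FiniteDimensional.proper ℝ E
  have hb : Bornology.IsBounded (f '' s) :=
    (Metric.isBounded_closedBall (x := (0 : E)) (r := R)).subset (by
      rintro _ ⟨i, hi, rfl⟩
      simpa using hR i hi)
  have htb : TotallyBounded (f '' s) := by
    refine TotallyBounded.subset subset_closure hb.isCompact_closure.totallyBounded
  obtain ⟨t, ht, hcov⟩ := Metric.totallyBounded_iff.1 htb (ε / 2) (half_pos hε)
  have hmem : ∀ i ∈ s, ∃ c ∈ t, f i ∈ Metric.ball c (ε / 2) := by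
    intro i hi
    simpa using hcov (mem_image_of_mem f hi)
  choose! c hc hcb using hmem
  obtain ⟨i, hi, j, hj, hij, he⟩ := hs.exists_ne_map_eq_of_mapsTo (f := c) (fun i hi => hc i hi) ht
  refine ⟨i, hi, j, hj, hij, ?_⟩
  have h1 := hcb i hi
  have h2 := hcb j hj
  rw [← he] at h2
  rw [← dist_eq_norm]
  have := dist_triangle_right (f i) (f j) (c i)
  rw [Metric.mem_ball] at h1 h2
  linarith

theorem norm_pow_sub_pow_le {R : Type*} [NormedRing R] [NormOneClass R] {a b : R} {c δ : ℝ}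
    (ha : ‖a‖ ≤ c) (hb : ‖b‖ ≤ c) (hc : 1 ≤ c) (hδ : ‖a - b‖ ≤ δ) (k : ℕ) :
    ‖a ^ k - b ^ k‖ ≤ k * c ^ k * δ := by
  have hδ0 : 0 ≤ δ := (norm_nonneg _).trans hδ
  induction k with
  | zero => simp
  | succ k ih =>
    have e : a ^ (k + 1) - b ^ (k + 1) = a * (a ^ k - b ^ k) + (a - b) * b ^ k := by
      rw [pow_succ', pow_succ']; noncomm_ring
    have hbk : ‖b ^ k‖ ≤ c ^ k := (norm_pow_le b k).trans (pow_le_pow_left₀ (norm_nonneg _) hb k)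
    calc ‖a ^ (k + 1) - b ^ (k + 1)‖
        ≤ ‖a‖ * ‖a ^ k - b ^ k‖ + ‖a - b‖ * ‖b ^ k‖ := by
          rw [e]
          exact (norm_add_le _ _).trans (add_le_add (norm_mul_le _ _) (norm_mul_le _ _))
      _ ≤ c * (k * c ^ k * δ) + δ * c ^ k := by gcongr
      _ ≤ c * (k * c ^ k * δ) + δ * c ^ (k + 1) := by
          gcongr
          omega
      _ = ((k + 1 : ℕ) : ℝ) * c ^ (k + 1) * δ := by push_cast; ring

-- Euler's formula with varying steps: one factor differs from `exp (η A)` by `o(η)`, since `A` is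
-- the derivative of `exp (u A)` at `0`. Over about `t / η` factors the error remains `o(1)`.
open Filter Topology in
theorem tendsto_one_add_smul_pow_exp {R : Type*} [NormedRing R] [NormedAlgebra ℝ R]
    [NormOneClass R] [CompleteSpace R] {A : R} {a : ℕ → R} {η : ℕ → ℝ}
    (ha : Tendsto a atTop (𝓝 A)) (ha1 : ∀ n, ‖a n‖ ≤ 1) (hη : Tendsto η atTop (𝓝 0))
    (hη0 : ∀ n, 0 < η n) {t : ℝ} (ht : 0 ≤ t) :
    Tendsto (fun n => (1 + η n • a n) ^ ⌊t / η n⌋₊) atTop (𝓝 (NormedSpace.exp (t • A))) := by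
  let _ : NormedAlgebra ℚ R := NormedAlgebra.restrictScalars ℚ ℝ R
  set k : ℕ → ℕ := fun n => ⌊t / η n⌋₊ with hk
  have hkle : ∀ n, (k n : ℝ) * η n ≤ t := fun n => by
    have := Nat.floor_le (div_nonneg ht (hη0 n).le)
    rwa [le_div_iff₀ (hη0 n)] at this
  have hkge : ∀ n, t - η n ≤ (k n : ℝ) * η n := fun n => by
    have := (Nat.lt_floor_add_one (t / η n)).le
    rw [div_le_iff₀ (hη0 n)] at this
    linarith
  have hkη : Tendsto (fun n => (k n : ℝ) * η n) atTop (𝓝 t) := by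
    refine tendsto_of_tendsto_of_tendsto_of_le_of_le ?_ tendsto_const_nhds hkge hkle
    simpa using tendsto_const_nhds.sub hη
  have hcont : Continuous fun s : ℝ => NormedSpace.exp (s • A) :=
    NormedSpace.exp_continuous.comp (continuous_id.smul continuous_const)
  have h1 : Tendsto (fun n => NormedSpace.exp (((k n : ℝ) * η n) • A)) atTop
      (𝓝 (NormedSpace.exp (t • A))) := (hcont.tendsto t).comp hkη
  set d : ℕ → ℝ := fun n => ‖(η n)⁻¹ • (NormedSpace.exp (η n • A) - 1) - a n‖ with hd
  have hd0 : Tendsto d atTop (𝓝 0) := by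
    have hder : HasDerivAt (fun u : ℝ => NormedSpace.exp (u • A)) A 0 := by
      simpa using hasDerivAt_exp_smul_const (𝕂 := ℝ) A 0
    have hs := hder.tendsto_slope_zero
    simp only [zero_add, zero_smul, NormedSpace.exp_zero] at hs
    have hη' : Tendsto η atTop (𝓝[≠] 0) :=
      tendsto_nhdsWithin_iff.2 ⟨hη, Eventually.of_forall fun n => (hη0 n).ne'⟩
    simpa using ((hs.comp hη').sub ha).norm
  have heq : ∀ n, ‖NormedSpace.exp (η n • A) - (1 + η n • a n)‖ = η n * d n := fun n => by
    have : NormedSpace.exp (η n • A) - (1 + η n • a n) =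
        η n • ((η n)⁻¹ • (NormedSpace.exp (η n • A) - 1) - a n) := by
      rw [smul_sub, smul_smul, mul_inv_cancel₀ (hη0 n).ne', one_smul]; abel
    rw [this, norm_smul, Real.norm_of_nonneg (hη0 n).le]
  have hbound : ∀ᶠ n in atTop, ‖NormedSpace.exp (((k n : ℝ) * η n) • A) -
      (1 + η n • a n) ^ k n‖ ≤ t * Real.exp (2 * t) * d n := by
    filter_upwards [hd0.eventually (gt_mem_nhds one_pos)] with n hn
    have hη := (hη0 n).le
    have hb : ‖1 + η n • a n‖ ≤ 1 + η n := by
      refine (norm_add_le _ _).trans ?_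
      rw [norm_one, norm_smul, Real.norm_of_nonneg hη]
      have := mul_le_mul_of_nonneg_left (ha1 n) hη
      linarith
    -- One `η` comes from `1 + η a`, the other from the one-step error `η d` with `d < 1`.
    have ha' : ‖NormedSpace.exp (η n • A)‖ ≤ 1 + 2 * η n := by
      have h2 := norm_le_norm_add_norm_sub' (NormedSpace.exp (η n • A)) (1 + η n • a n)
      rw [heq] at h2
      have h3 : η n * d n ≤ η n * 1 := mul_le_mul_of_nonneg_left hn.le hη
      linarith
    have key := norm_pow_sub_pow_le ha' (hb.trans (by linarith)) (by linarith) (heq n).le (k n)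
    have he : NormedSpace.exp (((k n : ℝ) * η n) • A) = NormedSpace.exp (η n • A) ^ k n := by
      rw [← NormedSpace.exp_nsmul, mul_smul, Nat.cast_smul_eq_nsmul]
    rw [he]
    refine key.trans ?_
    have hp : (1 + 2 * η n) ^ k n ≤ Real.exp (2 * t) := by
      have h4 : (1 + 2 * η n) ≤ Real.exp (2 * η n) := by
        linarith [Real.add_one_le_exp (2 * η n)]
      calc (1 + 2 * η n) ^ k n ≤ Real.exp (2 * η n) ^ k n :=
            pow_le_pow_left₀ (by linarith) h4 _
        _ = Real.exp (k n * (2 * η n)) := by rw [Real.exp_nat_mul]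
        _ ≤ Real.exp (2 * t) := Real.exp_le_exp.2 (by linarith [hkle n])
    have hdn : 0 ≤ d n := norm_nonneg _
    calc (k n : ℝ) * (1 + 2 * η n) ^ k n * (η n * d n)
        = ((k n : ℝ) * η n) * (1 + 2 * η n) ^ k n * d n := by ring
      _ ≤ t * Real.exp (2 * t) * d n := by
        gcongr
        exact hkle n
  have h2 : Tendsto (fun n => NormedSpace.exp (((k n : ℝ) * η n) • A) -
      (1 + η n • a n) ^ k n) atTop (𝓝 0) := by
    refine squeeze_zero_norm' hbound ?_
    simpa using hd0.const_mul (t * Real.exp (2 * t))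
  simpa using h1.sub h2

theorem homog_pow_apply (f : Plane →ᵃ[ℝ] Plane) (k : ℕ) (x : Plane) :
    (homog f ^ k) (x, 1) = (f^[k] x, 1) := by
  induction k with
  | zero => simp
  | succ k ih =>
    rw [pow_succ', mul_apply_eq_comp, ih, homog_apply_one,
      Function.iterate_succ_apply']

/-- While `k ‖homog f - 1‖ ≤ ε`, the `k`-th iterate has moved `x` by less than `r`, so it is still
in `D` and `f` may be applied once more. The constant `3` bounds `exp 1`. -/
theorem iterate_mem {γ D : Set Plane} {f : Plane →ᵃ[ℝ] Plane} {x : Plane} {r ε : ℝ}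
    (hx : x ∈ γ) (hf : ∀ z ∈ D, f z ∈ γ) (hD : ∀ z ∈ γ, dist z x < r → z ∈ D) (hε1 : ε ≤ 1)
    (hε : ε * (3 * (‖x‖ + 1)) < r) {k : ℕ} (hk : k * ‖homog f - 1‖ ≤ ε) : f^[k] x ∈ γ := by
  set η := ‖homog f - 1‖ with hη
  have hη0 : 0 ≤ η := norm_nonneg _
  induction k with
  | zero => simpa using hx
  | succ k ih =>
    have hk' : k * η ≤ ε := by
      refine le_trans ?_ hk
      gcongr
      simp
    rw [Function.iterate_succ_apply']
    refine hf _ (hD _ (ih hk') ?_)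
    have h1 : ‖homog f‖ ≤ 1 + η := by
      have := norm_le_norm_add_norm_sub' (homog f) 1
      rwa [norm_one] at this
    have h2 := norm_pow_sub_pow_le h1 (by rw [norm_one]; linarith) (by linarith) hη.symm.le k
    have h3 : (1 + η) ^ k ≤ 3 := by
      calc (1 + η) ^ k ≤ Real.exp η ^ k :=
            pow_le_pow_left₀ (by linarith) (by linarith [Real.add_one_le_exp η]) _
        _ = Real.exp (k * η) := by rw [Real.exp_nat_mul]
        _ ≤ Real.exp 1 := Real.exp_le_exp.2 (by linarith)
        _ ≤ 3 := by linarith [Real.exp_one_lt_d9]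
    have h4 : ‖homog f ^ k - 1 ^ k‖ ≤ ε * 3 := by
      refine h2.trans ?_
      calc k * (1 + η) ^ k * η = (k * η) * (1 + η) ^ k := by ring
        _ ≤ ε * 3 := mul_le_mul hk' h3 (by positivity) (le_trans (by positivity) hk')
    have h5 := (homog f ^ k - 1 ^ k).le_opNorm (x, 1)
    have h6 : (homog f ^ k - 1 ^ k) (x, 1) = (f^[k] x - x, 0) := by
      rw [sub_apply, homog_pow_apply, one_pow]
      simp
    have h7 : ‖((x, 1) : Plane × ℝ)‖ ≤ ‖x‖ + 1 := by
      rw [Prod.norm_def]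
      simp
    have h8 : ‖f^[k] x - x‖ ≤ ‖((f^[k] x - x, 0) : Plane × ℝ)‖ := by
      rw [Prod.norm_def]
      exact le_max_left _ _
    rw [h6] at h5
    rw [dist_eq_norm]
    have hε0 : 0 ≤ ε := le_trans (by positivity) hk'
    calc ‖f^[k] x - x‖ ≤ ‖homog f ^ k - 1 ^ k‖ * ‖((x, 1) : Plane × ℝ)‖ := h8.trans h5
      _ ≤ (ε * 3) * (‖x‖ + 1) := by gcongr
      _ = ε * (3 * (‖x‖ + 1)) := by ring
      _ < r := hε

/-- The first component of `exp (t A) (x, 1)` solves the affine equation given by `A`. -/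
theorem hasDerivAt_exp_homog {A : (Plane × ℝ) →L[ℝ] (Plane × ℝ)} (hA : ∀ v, (A v).2 = 0)
    (x : Plane) (t : ℝ) :
    HasDerivAt (fun u : ℝ => (NormedSpace.exp (u • A) (x, 1)).1)
      ((A ((NormedSpace.exp (t • A) (x, 1)).1, 1)).1) t := by
  have h1 : ∀ t : ℝ, HasDerivAt (fun u : ℝ => NormedSpace.exp (u • A) (x, 1))
      (A (NormedSpace.exp (t • A) (x, 1))) t := fun t => by
    have := (hasDerivAt_exp_smul_const' (𝕂 := ℝ) A t).clm_apply
      (hasDerivAt_const t ((x, 1) : Plane × ℝ))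
    simpa using this
  have h2 : ∀ t : ℝ, (NormedSpace.exp (t • A) (x, 1)).2 = 1 := fun t => by
    have hd : ∀ t : ℝ, HasDerivAt (fun u : ℝ => (NormedSpace.exp (u • A) (x, 1)).2) 0 t :=
      fun t => by
        have := (ContinuousLinearMap.snd ℝ Plane ℝ).hasFDerivAt.comp_hasDerivAt t (h1 t)
        rw [ContinuousLinearMap.coe_snd', hA] at this
        exact this
    have := is_const_of_deriv_eq_zero (fun t => (hd t).differentiableAt) (fun t => (hd t).deriv)
      t 0
    rw [this, zero_smul ℝ A, NormedSpace.exp_zero]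
    rfl
  have h3 := (ContinuousLinearMap.fst ℝ Plane ℝ).hasFDerivAt.comp_hasDerivAt t (h1 t)
  have h4 : NormedSpace.exp (t • A) (x, 1) = ((NormedSpace.exp (t • A) (x, 1)).1, 1) :=
    Prod.ext rfl (h2 t)
  rw [h4] at h3
  exact h3

-- The generator `A` is a limit of normalized displacements `(homog f - 1) / ‖homog f - 1‖`, and
-- about `t / ‖homog f - 1‖` iterations of `f` approximate `exp (t A)`. The iterates stay in the
-- closed set `γ`, hence so does the limit.
open Filter Topology in
theorem exists_orbit_subset {γ D W : Set Plane} {r : ℝ} (hγ : IsClosed γ) (hWγ : W ⊆ γ)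
    (hWne : W.Nonempty) (hW : ¬ IsFlat W) (hr : 0 < r)
    (hD : ∀ x ∈ W, ∀ z ∈ γ, dist z x < r → z ∈ D)
    (hg : ∀ ε : ℝ, 0 < ε → ∃ f : Plane →ᵃ[ℝ] Plane,
      homog f ≠ 1 ∧ ‖homog f - 1‖ < ε ∧ ∀ z ∈ D, f z ∈ γ) :
    ∃ (M : Plane →L[ℝ] Plane) (b : Plane) (X : ℝ → Plane) (ε : ℝ), 0 < ε ∧
      (∀ t, HasDerivAt X (M (X t) + b) t) ∧ M (X 0) + b ≠ 0 ∧ ∀ t ∈ Icc 0 ε, X t ∈ γ := by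
  choose f hf1 hf2 hfD using fun n : ℕ => hg (1 / ((n : ℝ) + 1)) Nat.one_div_pos_of_nat
  set η : ℕ → ℝ := fun n => ‖homog (f n) - 1‖ with hη
  have hη0 : ∀ n, 0 < η n := fun n => norm_pos_iff.2 (sub_ne_zero.2 (hf1 n))
  have hηlim : Tendsto η atTop (𝓝 0) :=
    squeeze_zero (fun n => (hη0 n).le) (fun n => (hf2 n).le) tendsto_one_div_add_atTop_nhds_zero_nat
  set a : ℕ → ((Plane × ℝ) →L[ℝ] (Plane × ℝ)) := fun n => (η n)⁻¹ • (homog (f n) - 1) with ha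
  have hanorm : ∀ n, ‖a n‖ = 1 := fun n => by
    rw [ha]
    simp only [norm_smul, norm_inv, Real.norm_of_nonneg (hη0 n).le]
    exact inv_mul_cancel₀ (hη0 n).ne'
  have hah : ∀ n, 1 + η n • a n = homog (f n) := fun n => by
    rw [ha]
    simp only [smul_smul]
    rw [mul_inv_cancel₀ (hη0 n).ne', one_smul]
    abel
  have : ProperSpace ((Plane × ℝ) →L[ℝ] (Plane × ℝ)) := FiniteDimensional.proper ℝ _
  obtain ⟨A, hAmem, φ, hφ, hAlim⟩ :=
    (isCompact_sphere (0 : (Plane × ℝ) →L[ℝ] (Plane × ℝ)) 1).tendsto_subseq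
      (fun n => by simpa using hanorm n)
  have hAnorm : ‖A‖ = 1 := by simpa using hAmem
  have hA2 : ∀ v, (A v).2 = 0 := fun v => by
    have h1 : Tendsto (fun n => ((a ∘ φ) n v).2) atTop (𝓝 (A v).2) := by
      have hc : Continuous fun B : (Plane × ℝ) →L[ℝ] (Plane × ℝ) => (B v).2 := by fun_prop
      exact (hc.tendsto A).comp hAlim
    have h2 : ∀ n, ((a ∘ φ) n v).2 = 0 := fun n => by
      simp [ha, homog_apply]
    simp only [h2] at h1
    exact (tendsto_nhds_unique h1 tendsto_const_nhds)
  -- A generator of norm one cannot vanish on a non-flat set, so some orbit starting in `W` is not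
  -- stationary.
  obtain ⟨x, hxW, hx⟩ : ∃ x ∈ W, A (x, 1) ≠ 0 := by
    by_contra! hcon
    obtain ⟨C, -, hC⟩ := exists_norm_le_of_not_isFlat hWne hW
    have := hC A 0 le_rfl fun x hx => by simp [hcon x hx]
    rw [hAnorm] at this
    linarith
  obtain ⟨ε, hε0, hε1, hε⟩ : ∃ ε : ℝ, 0 < ε ∧ ε ≤ 1 ∧ ε * (3 * (‖x‖ + 1)) < r := by
    have hpos : 0 < 3 * (‖x‖ + 1) := by positivity
    refine ⟨min 1 (r / 2 / (3 * (‖x‖ + 1))), by positivity, min_le_left _ _, ?_⟩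
    calc min 1 (r / 2 / (3 * (‖x‖ + 1))) * (3 * (‖x‖ + 1))
        ≤ (r / 2 / (3 * (‖x‖ + 1))) * (3 * (‖x‖ + 1)) := by
          gcongr
          exact min_le_right _ _
      _ = r / 2 := div_mul_cancel₀ _ hpos.ne'
      _ < r := half_lt_self hr
  have hAb : ∀ y : Plane, (A (y, 1)).1 = ((ContinuousLinearMap.fst ℝ Plane ℝ).comp
      (A.comp (ContinuousLinearMap.inl ℝ Plane ℝ))) y + (A (0, 1)).1 := fun y => by
    simp only [ContinuousLinearMap.comp_apply, ContinuousLinearMap.inl_apply,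
      ContinuousLinearMap.coe_fst']
    rw [← Prod.fst_add, ← map_add]
    simp
  refine ⟨(ContinuousLinearMap.fst ℝ Plane ℝ).comp (A.comp (ContinuousLinearMap.inl ℝ Plane ℝ)),
    (A (0, 1)).1, fun u : ℝ => (NormedSpace.exp (u • A) (x, 1)).1, ε, hε0, fun t => ?_,
    ?_, fun t ht => ?_⟩
  · have := hasDerivAt_exp_homog hA2 x t
    rwa [hAb] at this
  · rw [← hAb]
    beta_reduce
    rw [zero_smul ℝ A, NormedSpace.exp_zero]
    exact fun h => hx (Prod.ext h (hA2 _))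
  · have hlim := tendsto_one_add_smul_pow_exp hAlim (fun n => (hanorm _).le)
      (hηlim.comp hφ.tendsto_atTop) (fun n => hη0 _) ht.1
    have hc : Continuous fun B : (Plane × ℝ) →L[ℝ] (Plane × ℝ) => (B (x, 1)).1 := by fun_prop
    refine hγ.mem_of_tendsto ((hc.tendsto _).comp hlim) (Eventually.of_forall fun n => ?_)
    simp only [Function.comp_apply, hah, homog_pow_apply]
    refine iterate_mem (hWγ hxW) (hfD _) (hD x hxW) hε1 hε ?_
    have := Nat.floor_le (div_nonneg ht.1 (hη0 (φ n)).le)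
    rw [le_div_iff₀ (hη0 (φ n))] at this
    exact this.trans ht.2

/-! ### Determinant, trace and Cayley–Hamilton in the plane -/

/-- The determinant of two vectors of the plane. -/
def cross (x y : Plane) : ℝ := x 0 * y 1 - x 1 * y 0

theorem cross_same (x : Plane) : cross x x = 0 := by simp only [cross]; ring

theorem cross_add_right (x y z : Plane) : cross x (y + z) = cross x y + cross x z := by
  simp only [cross, PiLp.add_apply]; ring

theorem cross_smul_right (x y : Plane) (a : ℝ) : cross x (a • y) = a * cross x y := by
  simp only [cross, PiLp.smul_apply, smul_eq_mul]; ring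

theorem cross_add_left (x y z : Plane) : cross (x + y) z = cross x z + cross y z := by
  simp only [cross, PiLp.add_apply]; ring

theorem cross_smul_left (x y : Plane) (a : ℝ) : cross (a • x) y = a * cross x y := by
  simp only [cross, PiLp.smul_apply, smul_eq_mul]; ring

theorem plane_ext {x y : Plane} (h0 : x 0 = y 0) (h1 : x 1 = y 1) : x = y := by
  ext i; fin_cases i <;> assumption

theorem eq_smul_of_cross_eq_zero {x y : Plane} (hx : x ≠ 0) (h : cross x y = 0) :
    ∃ a : ℝ, y = a • x := by
  simp only [cross] at h
  by_cases h0 : x 0 = 0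
  · have h1 : x 1 ≠ 0 := fun h1 => hx (plane_ext (by simpa using h0) (by simpa using h1))
    refine ⟨y 1 / x 1, plane_ext ?_ ?_⟩
    · simp only [PiLp.smul_apply, smul_eq_mul]; field_simp; linarith
    · simp only [PiLp.smul_apply, smul_eq_mul]; field_simp
  · refine ⟨y 0 / x 0, plane_ext ?_ ?_⟩
    · simp only [PiLp.smul_apply, smul_eq_mul]; field_simp
    · simp only [PiLp.smul_apply, smul_eq_mul]; field_simp; linarith

theorem linearIndependent_of_cross_ne_zero {x y : Plane} (h : cross x y ≠ 0) :
    LinearIndependent ℝ ![x, y] := by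
  rw [LinearIndependent.pair_iff]
  intro a b hab
  have h1 : b * cross x y = 0 := by
    have := congrArg (cross x) hab
    rw [cross_add_right, cross_smul_right, cross_smul_right, cross_same] at this
    rw [mul_zero, zero_add] at this
    rw [this]; simp [cross]
  have h2 : a * cross x y = 0 := by
    have := congrArg (fun z => cross z y) hab
    simp only [cross_add_left, cross_smul_left, cross_same] at this
    rw [mul_zero, add_zero] at this
    rw [this]; simp [cross]
  exact ⟨(mul_eq_zero.1 h2).resolve_right h, (mul_eq_zero.1 h1).resolve_right h⟩

theorem exists_coord (M : Plane →ₗ[ℝ] Plane) : ∃ p q r s : ℝ, ∀ x : Plane,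
    M x 0 = p * x 0 + q * x 1 ∧ M x 1 = r * x 0 + s * x 1 := by
  have h : ∀ x : Plane, x = x 0 • EuclideanSpace.single (0 : Fin 2) (1 : ℝ) +
      x 1 • EuclideanSpace.single (1 : Fin 2) (1 : ℝ) := fun x =>
    plane_ext (by simp) (by simp)
  refine ⟨M (EuclideanSpace.single 0 1) 0, M (EuclideanSpace.single 1 1) 0,
    M (EuclideanSpace.single 0 1) 1, M (EuclideanSpace.single 1 1) 1, fun x => ?_⟩
  constructor <;>
  · conv_lhs => rw [h x]
    simp only [map_add, map_smul, PiLp.add_apply, PiLp.smul_apply, smul_eq_mul]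
    ring

theorem exists_trace_det (M : Plane →ₗ[ℝ] Plane) : ∃ τ Δ : ℝ,
    (∀ x, M (M x) = τ • M x - Δ • x) ∧ (∀ x y, cross (M x) y + cross x (M y) = τ * cross x y) ∧
      ∀ x y, cross (M x) (M y) = Δ * cross x y := by
  obtain ⟨p, q, r, s, h⟩ := exists_coord M
  refine ⟨p + s, p * s - q * r, fun x => plane_ext ?_ ?_, fun x y => ?_, fun x y => ?_⟩
  · simp only [PiLp.sub_apply, PiLp.smul_apply, smul_eq_mul, (h _).1, (h _).2]; ring
  · simp only [PiLp.sub_apply, PiLp.smul_apply, smul_eq_mul, (h _).1, (h _).2]; ring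
  · simp only [cross, (h _).1, (h _).2]; ring
  · simp only [cross, (h _).1, (h _).2]; ring

theorem hasDerivAt_cross {f g : ℝ → Plane} {f' g' : Plane} {t : ℝ} (hf : HasDerivAt f f' t)
    (hg : HasDerivAt g g' t) :
    HasDerivAt (fun u => cross (f u) (g u)) (cross f' (g t) + cross (f t) g') t := by
  have hc : ∀ {k : ℝ → Plane} {k' : Plane}, HasDerivAt k k' t → ∀ i,
      HasDerivAt (fun u => k u i) (k' i) t := fun hk i =>
    (EuclideanSpace.proj i : Plane →L[ℝ] ℝ).hasFDerivAt.comp_hasDerivAt t hk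
  have := ((hc hf 0).mul (hc hg 1)).sub ((hc hf 1).mul (hc hg 0))
  refine this.congr_deriv ?_
  simp only [cross]; ring

theorem eq_zero_of_hasDerivAt_mul {f : ℝ → ℝ} {κ t₀ : ℝ}
    (hf : ∀ t, HasDerivAt f (κ * f t) t) (h0 : f t₀ = 0) (t : ℝ) : f t = 0 := by
  have hd : ∀ t, HasDerivAt (fun u => f u * Real.exp (-κ * u)) 0 t := fun t => by
    have := (hf t).mul ((hasDerivAt_id t).const_mul (-κ)).exp
    refine this.congr_deriv ?_
    simp only [id]; ring
  have := is_const_of_deriv_eq_zero (fun t => (hd t).differentiableAt) (fun t => (hd t).deriv) t t₀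
  simp only [h0, zero_mul, mul_eq_zero, Real.exp_ne_zero, or_false] at this
  exact this

/-! ### Orbits of planar affine fields -/

section Orbit

variable {M : Plane →L[ℝ] Plane} {b : Plane} {Y : ℝ → Plane}

theorem hasDerivAt_velocity (hY : ∀ t, HasDerivAt Y (M (Y t) + b) t) (t : ℝ) :
    HasDerivAt (fun u => M (Y u) + b) (M (M (Y t) + b)) t :=
  (M.hasFDerivAt.comp_hasDerivAt t (hY t)).add_const b

/-- If the velocity `e` at one time is an eigenvector of `M`, then `cross e` of the velocity solves
a homogeneous scalar linear equation with a zero, so the velocity is always parallel to `e`. -/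
theorem isFlat_range_of_cross_eq_zero (hY : ∀ t, HasDerivAt Y (M (Y t) + b) t) {t₀ : ℝ}
    (hne : M (Y t₀) + b ≠ 0) (h0 : cross (M (Y t₀) + b) (M (M (Y t₀) + b)) = 0) :
    IsFlat (range Y) := by
  obtain ⟨κ, hκ⟩ := eq_smul_of_cross_eq_zero hne h0
  obtain ⟨τ, Δ, -, hτ, -⟩ := exists_trace_det (M : Plane →ₗ[ℝ] Plane)
  simp only [ContinuousLinearMap.coe_coe] at hτ
  set e := M (Y t₀) + b with he
  have hf : ∀ t, cross e (M (Y t) + b) = 0 := by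
    refine eq_zero_of_hasDerivAt_mul (κ := τ - κ) (t₀ := t₀) (fun t => ?_) (cross_same e)
    refine (hasDerivAt_cross (hasDerivAt_const t e) (hasDerivAt_velocity hY t)).congr_deriv ?_
    have h1 := hτ e (M (Y t) + b)
    rw [hκ, cross_smul_left] at h1
    have h2 : cross 0 (M (Y t) + b) = 0 := by simp [cross]
    rw [h2]
    linarith
  have hd : ∀ t, HasDerivAt (fun u => cross e (Y u)) 0 t := fun t => by
    refine (hasDerivAt_cross (hasDerivAt_const t e) (hY t)).congr_deriv ?_
    rw [hf]
    simp [cross]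
  refine ⟨{ toFun := cross e, map_add' := cross_add_right e,
            map_smul' := fun a x => cross_smul_right e x a }, cross e (Y t₀), ?_, ?_⟩
  · intro h
    have h1 : ∀ x, cross e x = 0 := fun x => LinearMap.congr_fun h x
    apply hne
    refine plane_ext ?_ ?_
    · simpa [cross] using h1 (EuclideanSpace.single 1 1)
    · simpa [cross] using h1 (EuclideanSpace.single 0 1)
  · rintro _ ⟨t, rfl⟩
    exact is_const_of_deriv_eq_zero (fun t => (hd t).differentiableAt) (fun t => (hd t).deriv) t t₀

/-- A time change `φ` that carries an orbit of an affine field with trace `τ` and determinant `Δ`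
to an affine image of it is a translation or a reflection unless `9 Δ = 2 τ ^ 2`. -/
theorem det_eq_of_conj (hY : ∀ t, HasDerivAt Y (M (Y t) + b) t) {τ Δ : ℝ}
    (hCH : ∀ x, M (M x) = τ • M x - Δ • x)
    (hτ : ∀ x y, cross (M x) y + cross x (M y) = τ * cross x y)
    {L : Plane →L[ℝ] Plane} {φ ρ : ℝ → ℝ} {U : Set ℝ} (hU : IsOpen U)
    (hφ : ∀ t ∈ U, HasDerivAt φ (ρ t) t) (hρ : ∀ t ∈ U, ρ t ≠ 0)
    (hρd : ∀ t ∈ U, DifferentiableAt ℝ ρ t)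
    (hL : ∀ t ∈ U, L (M (Y t) + b) = ρ t • (M (Y (φ t)) + b))
    (hcross : ∀ t ∈ U, cross (M (Y (φ t)) + b) (M (M (Y (φ t)) + b)) ≠ 0) {t : ℝ} (ht : t ∈ U)
    (hρ1 : ρ t ^ 2 ≠ 1) : 9 * Δ = 2 * τ ^ 2 := by
  obtain ⟨-, lam, -, -, hlam⟩ := exists_trace_det (L : Plane →ₗ[ℝ] Plane)
  simp only [ContinuousLinearMap.coe_coe] at hlam
  set v : ℝ → Plane := fun t => M (Y t) + b with hv
  set w : ℝ → Plane := fun t => M (Y (φ t)) + b with hw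
  have hv' : ∀ t, HasDerivAt v (M (v t)) t := hasDerivAt_velocity hY
  have hw' : ∀ t ∈ U, HasDerivAt w (ρ t • M (w t)) t := fun t ht =>
    (hasDerivAt_velocity hY (φ t)).scomp t (hφ t ht)
  have hMw' : ∀ t ∈ U, HasDerivAt (fun t => M (w t)) (ρ t • M (M (w t))) t := fun t ht => by
    have := M.hasFDerivAt.comp_hasDerivAt t (hw' t ht)
    rwa [map_smul] at this
  have hLv : ∀ t ∈ U, L (M (v t)) = (ρ t * ρ t) • M (w t) + deriv ρ t • w t := fun t ht => by
    have h1 := L.hasFDerivAt.comp_hasDerivAt t (hv' t)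
    have h2 := (hρd t ht).hasDerivAt.smul (hw' t ht)
    have h3 : (fun t => L (v t)) =ᶠ[nhds t] fun t => ρ t • w t := by
      filter_upwards [hU.mem_nhds ht] with s hs using hL s hs
    have h4 := (h1.congr_of_eventuallyEq h3.symm).unique h2
    rw [h4, smul_smul]
  -- Here `lam` is the determinant of `L`; the `ρ'` term of `L (M v)` is parallel to `w` and drops
  -- out.
  have hlamD : ∀ t ∈ U, lam * cross (v t) (M (v t)) = ρ t ^ 3 * cross (w t) (M (w t)) :=
    fun t ht => by
      rw [← hlam, hLv t ht, hL t ht]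
      change cross (ρ t • w t) _ = _
      rw [cross_smul_left, cross_add_right, cross_smul_right, cross_smul_right, cross_same]
      ring
  -- Along the orbit `cross v (M v)` has logarithmic derivative `τ`; differentiating `hlamD` gives
  -- an equation for `ρ` alone.
  have hρ' : ∀ t ∈ U, deriv ρ t = τ * ρ t * (1 - ρ t) / 3 := fun t ht => by
    have hMv' : HasDerivAt (fun t => M (v t)) (M (M (v t))) t :=
      M.hasFDerivAt.comp_hasDerivAt t (hv' t)
    have h1 := (hasDerivAt_cross (hv' t) hMv').const_mul lam
    have h2 := ((hρd t ht).hasDerivAt.pow 3).mul (hasDerivAt_cross (hw' t ht) (hMw' t ht))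
    have h3 : (fun t => lam * cross (v t) (M (v t))) =ᶠ[nhds t]
        fun t => ρ t ^ 3 * cross (w t) (M (w t)) := by
      filter_upwards [hU.mem_nhds ht] with s hs using hlamD s hs
    have h4 := (h1.congr_of_eventuallyEq h3.symm).unique h2
    have h5 := hτ (w t) (M (w t))
    rw [hτ, cross_smul_left, cross_smul_right, ← mul_add, h5] at h4
    have h6 := hlamD t ht
    have h7 := hcross t ht
    have h8 := hρ t ht
    change cross (w t) (M (w t)) ≠ 0 at h7
    have h9 : ρ t ^ 2 * cross (w t) (M (w t)) * (deriv ρ t - τ * ρ t * (1 - ρ t) / 3) = 0 := by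
      simp only [Pi.pow_apply] at h4
      push_cast at h4
      linear_combination (-1 / 3 : ℝ) * h4 + (τ / 3) * h6
    have h10 := (mul_eq_zero.1 h9).resolve_left (mul_ne_zero (pow_ne_zero 2 h8) h7)
    linarith
  set g : ℝ → ℝ := fun t => τ * ρ t * (1 - ρ t) / 3 with hg
  have hρder : HasDerivAt ρ (g t) t := by
    have := (hρd t ht).hasDerivAt
    rwa [hρ' t ht] at this
  have hgder : HasDerivAt g (τ * g t * (1 - 2 * ρ t) / 3) t := by
    have := (((hρder.const_mul τ).mul (hρder.const_sub 1))).div_const 3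
    refine this.congr_deriv ?_
    ring
  have hMv' : HasDerivAt (fun t => M (v t)) (M (M (v t))) t :=
    M.hasFDerivAt.comp_hasDerivAt t (hv' t)
  have h1 := L.hasFDerivAt.comp_hasDerivAt t hMv'
  have h2 := ((hρder.mul hρder).smul (hMw' t ht)).add (hgder.smul (hw' t ht))
  have h3 : (fun t => L (M (v t))) =ᶠ[nhds t]
      (fun t => (ρ * ρ) t • M (w t)) + fun t => g t • w t := by
    filter_upwards [hU.mem_nhds ht] with s hs
    rw [hLv s hs, hρ' s hs]
    rfl
  have h4 := (h1.congr_of_eventuallyEq h3.symm).unique h2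
  have hLw : L (v t) = ρ t • w t := hL t ht
  rw [hCH, map_sub, map_smul, map_smul, hLv t ht, hρ' t ht, hLw, hCH] at h4
  -- This isolates the coefficient of `w` in the second derivative of `L v = ρ w`.
  have h5 := congrArg (fun z => cross z (M (w t))) h4
  have hsub : ∀ x y z, cross (x - y) z = cross x z - cross y z := fun x y z => by
    simp only [cross, PiLp.sub_apply]; ring
  simp only [hsub, cross_add_left, cross_smul_left, cross_same, Pi.mul_apply] at h5
  have h7 : cross (w t) (M (w t)) ≠ 0 := hcross t ht
  have h8 : cross (w t) (M (w t)) * (ρ t * ((1 - ρ t ^ 2) * (9 * Δ - 2 * τ ^ 2))) = 0 := by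
    simp only [hg] at h5
    linear_combination (-9 : ℝ) * h5
  have h9 := (mul_eq_zero.1 ((mul_eq_zero.1 ((mul_eq_zero.1 h8).resolve_left h7)).resolve_left
    (hρ t ht))).resolve_left (sub_ne_zero.2 (Ne.symm hρ1))
  linarith

theorem exists_time_change (μ c : ℝ) : ∃ s : ℝ → ℝ, s c = 0 ∧
    ∀ t, HasDerivAt s (1 + μ * s t) t ∧ 0 < 1 + μ * s t := by
  by_cases hμ : μ = 0
  · refine ⟨fun t => t - c, by simp, fun t => ⟨?_, ?_⟩⟩
    · simpa [hμ] using (hasDerivAt_id t).sub_const c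
    · simp [hμ]
  · have he : ∀ t, 1 + μ * ((Real.exp (μ * (t - c)) - 1) / μ) = Real.exp (μ * (t - c)) :=
      fun t => by field_simp; ring
    refine ⟨fun t => (Real.exp (μ * (t - c)) - 1) / μ, by simp, fun t => ⟨?_, ?_⟩⟩
    · rw [he]
      have := ((((hasDerivAt_id t).sub_const c).const_mul μ).exp.sub_const 1).div_const μ
      refine this.congr_deriv ?_
      simp only [id, mul_one]
      field_simp
    · rw [he]
      exact Real.exp_pos _

/-- Since `(M - μ) (M - 2 μ) = 0`, the new time `s` with `s' = 1 + μ s` turns the exponentials of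
the flow into a polynomial of degree two; uniqueness for the differential equation identifies it
with `Y`. -/
theorem isParabolaSegment_of_orbit (hY : ∀ t, HasDerivAt Y (M (Y t) + b) t) {μ c d : ℝ}
    (hM : ∀ x, M (M x) = (3 * μ) • M x - (2 * μ ^ 2) • x) (hcd : c < d)
    (hcross : cross (M (Y c) + b) (M (M (Y c) + b)) ≠ 0) : IsParabolaSegment (Y '' Icc c d) := by
  obtain ⟨s, hs0, hs⟩ := exists_time_change μ c
  set V := M (Y c) + b with hV
  -- Chosen so that `M P = 2 μ P` and `M V = μ V + 2 P`.
  set P : Plane := (1 / 2 : ℝ) • (M V - μ • V) with hP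
  set Q : ℝ → Plane := fun x => Y c + x • V + x ^ 2 • P with hQ
  have hQd : ∀ t, HasDerivAt (fun t => Q (s t)) (M (Q (s t)) + b) t := fun t => by
    have h1 : HasDerivAt Q (V + (2 * s t) • P) (s t) := by
      have := (((hasDerivAt_id (s t)).smul_const V).const_add (Y c)).add
        (((hasDerivAt_id (s t)).pow 2).smul_const P)
      refine this.congr_deriv ?_
      simp
    refine (h1.scomp t (hs t).1).congr_deriv ?_
    have hMP : M P = (2 * μ) • P := by
      rw [hP, map_smul, map_sub, map_smul, hM]
      module
    have hMV : M V = μ • V + (2 : ℝ) • P := by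
      rw [hP]; module
    have hb : b = V - M (Y c) := by rw [hV]; abel
    rw [hQ, hb]
    simp only [map_add, map_smul, hMP, hMV]
    module
  have hYQ : Y = fun t => Q (s t) := by
    refine ODE_solution_unique_univ (v := fun _ x => M x + b) (s := fun _ => univ) (K := ‖M‖₊)
      (t₀ := c) (fun t => ?_) (fun t => ⟨hY t, mem_univ _⟩) (fun t => ⟨hQd t, mem_univ _⟩) ?_
    · refine LipschitzWith.lipschitzOnWith ?_
      simpa using M.lipschitz.add (LipschitzWith.const b)
    · simp [hQ, hs0]
  have hmono : StrictMono s := strictMono_of_deriv_pos fun t => by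
    rw [(hs t).1.deriv]; exact (hs t).2
  have hcont : Continuous s := continuous_iff_continuousAt.2 fun t => (hs t).1.continuousAt
  have himg : s '' Icc c d = Icc (s c) (s d) := by
    refine Subset.antisymm ?_ (intermediate_value_Icc hcd.le hcont.continuousOn)
    rintro _ ⟨t, ht, rfl⟩
    exact ⟨hmono.monotone ht.1, hmono.monotone ht.2⟩
  refine ⟨Y c, V, P, s c, s d, linearIndependent_of_cross_ne_zero ?_, hmono hcd, ?_⟩
  · rw [hP, cross_smul_right, sub_eq_add_neg, ← neg_smul, cross_add_right, cross_smul_right,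
      cross_same, mul_zero, add_zero]
    exact mul_ne_zero (by norm_num) hcross
  · rw [← himg, image_image]
    conv_lhs => rw [hYQ]

end Orbit

/-! ### Flat arcs and orbit arcs -/

theorem isStraightSegment_of_isFlat {γ : Set Plane} (hf : IsFlat γ) (hγ : IsCompact γ)
    (cγ : IsPreconnected γ) (nγ : γ.Nontrivial) : IsStraightSegment γ := by
  obtain ⟨l, c, hl, hlc⟩ := hf
  obtain ⟨x₀, hx₀⟩ := nγ.nonempty
  -- A direction vector of the line: `cross e = -l`.
  set e : Plane := !₂[-l (EuclideanSpace.single 1 1), l (EuclideanSpace.single 0 1)] with he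
  have hle : ∀ y, cross e y = -l y := fun y => by
    have h : y = y 0 • EuclideanSpace.single (0 : Fin 2) (1 : ℝ) +
        y 1 • EuclideanSpace.single (1 : Fin 2) (1 : ℝ) := plane_ext (by simp) (by simp)
    conv_rhs => rw [h]
    simp only [cross, he, map_add, map_smul, smul_eq_mul]
    simp
    ring
  have he0 : e ≠ 0 := fun h => hl (LinearMap.ext fun y => by
    have := hle y
    rw [h] at this
    simpa [cross] using this.symm)
  set k : ℝ →ᵃ[ℝ] Plane := AffineMap.lineMap x₀ (x₀ + e) with hk
  have hk' : ∀ a, k a = x₀ + a • e := fun a => by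
    simp [hk, AffineMap.lineMap_apply, add_comm]
  set f : Plane → ℝ := fun y => inner ℝ e (y - x₀) / inner ℝ e e with hf
  have hkf : ∀ y ∈ γ, k (f y) = y := fun y hy => by
    have h1 : cross e (y - x₀) = 0 := by
      rw [hle, map_sub, hlc y hy, hlc x₀ hx₀, sub_self, neg_zero]
    obtain ⟨a, ha⟩ := eq_smul_of_cross_eq_zero he0 h1
    have h2 : f y = a := by
      rw [hf]
      simp only [ha, inner_smul_right]
      exact mul_div_cancel_right₀ _ (inner_self_eq_zero.not.2 he0)
    rw [hk', h2, ← ha]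
    abel
  have hfc : Continuous f := by fun_prop
  have hconn : IsConnected (f '' γ) := ⟨nγ.nonempty.image f, cγ.image f hfc.continuousOn⟩
  have hIcc := eq_Icc_of_connected_compact hconn (hγ.image hfc)
  set α := sInf (f '' γ)
  set β := sSup (f '' γ)
  have hαβ : α ≤ β := by
    obtain ⟨z, hz⟩ := hconn.nonempty
    rw [hIcc] at hz
    exact hz.1.trans hz.2
  have hγk : γ = segment ℝ (k α) (k β) := by
    rw [← image_segment ℝ k α β, segment_eq_Icc hαβ, ← hIcc, image_image]
    ext y
    constructor
    · intro hy
      exact ⟨y, hy, hkf y hy⟩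
    · rintro ⟨z, hz, rfl⟩
      simpa only [hkf z hz] using hz
  refine ⟨k α, k β, fun h => ?_, hγk⟩
  rw [h, segment_same] at hγk
  rw [hγk] at nγ
  exact not_nontrivial_singleton nγ

theorem AffineEquiv.apply_eq_linear_add (T : Plane ≃ᵃ[ℝ] Plane) (x : Plane) :
    T x = T.linear x + T 0 := by
  have := (T : Plane →ᵃ[ℝ] Plane).map_vadd 0 x
  simpa using this

theorem strictMonoOn_of_orbit {M : Plane →L[ℝ] Plane} {b : Plane} {Y : ℝ → Plane}
    (hY : ∀ t, HasDerivAt Y (M (Y t) + b) t) {l : Plane →L[ℝ] ℝ} {c d : ℝ}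
    (hl : ∀ t ∈ Icc c d, 0 < l (M (Y t) + b)) : StrictMonoOn (fun t => l (Y t)) (Icc c d) := by
  have hu : ∀ t, HasDerivAt (fun t => l (Y t)) (l (M (Y t) + b)) t := fun t =>
    l.hasFDerivAt.comp_hasDerivAt t (hY t)
  refine strictMonoOn_of_deriv_pos (convex_Icc c d)
    (fun t _ => (hu t).continuousAt.continuousWithinAt) fun t ht => ?_
  rw [(hu t).deriv]
  exact hl t (interior_subset ht)

/-- Pull the orbit back by a piece map `T` sending `γ` into it. A functional `l` increasing along
the pulled-back orbit serves as a coordinate, and the connected set `γ` fills an interval of it. -/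
theorem exists_orbit_param {γ : Set Plane} (hγ : IsCompact γ) (cγ : IsPreconnected γ)
    (nγ : γ.Nontrivial)
    (hpiece : ∀ D ⊆ γ, IsPreconnected D → D.Nontrivial → ∃ T : Plane ≃ᵃ[ℝ] Plane, T '' γ ⊆ D)
    {M : Plane →L[ℝ] Plane} {b : Plane} {X : ℝ → Plane} {ε : ℝ} (hε : 0 < ε)
    (hX : ∀ t, HasDerivAt X (M (X t) + b) t) (hne : M (X 0) + b ≠ 0)
    (hsub : ∀ t ∈ Icc 0 ε, X t ∈ γ) :
    ∃ (M' : Plane →L[ℝ] Plane) (b' : Plane) (Y : ℝ → Plane) (l : Plane →L[ℝ] ℝ) (c d : ℝ),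
      c < d ∧ (∀ t, HasDerivAt Y (M' (Y t) + b') t) ∧ (∀ t ∈ Icc c d, 0 < l (M' (Y t) + b')) ∧
        γ = Y '' Icc c d := by
  have hXc : Continuous X := continuous_iff_continuousAt.2 fun t => (hX t).continuousAt
  set l₀ : Plane →L[ℝ] ℝ := innerSL ℝ (M (X 0) + b) with hl₀
  obtain ⟨ε', hε', hεε', hpos⟩ : ∃ ε', 0 < ε' ∧ ε' ≤ ε ∧
      ∀ t ∈ Icc 0 ε', 0 < l₀ (M (X t) + b) := by
    have hc : Continuous fun t => l₀ (M (X t) + b) := by fun_prop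
    have h0 : 0 < l₀ (M (X 0) + b) := by
      rw [hl₀, innerSL_apply_apply]
      exact real_inner_self_pos.2 hne
    obtain ⟨r, hr, hball⟩ := Metric.mem_nhds_iff.1
      ((isOpen_lt continuous_const hc).mem_nhds (x := 0) h0)
    refine ⟨min ε (r / 2), lt_min hε (half_pos hr), min_le_left _ _, fun t ht => hball ?_⟩
    rw [Metric.mem_ball, Real.dist_0_eq_abs, abs_of_nonneg ht.1]
    linarith [ht.2.trans (min_le_right ε (r / 2))]
  have hmono₀ := strictMonoOn_of_orbit hX hpos
  obtain ⟨T, hT⟩ := hpiece (X '' Icc 0 ε')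
    (by rintro _ ⟨t, ht, rfl⟩; exact hsub t ⟨ht.1, ht.2.trans hεε'⟩)
    (isPreconnected_Icc.image _ hXc.continuousOn)
    ⟨X 0, ⟨0, ⟨le_rfl, hε'.le⟩, rfl⟩, X ε', ⟨ε', ⟨hε'.le, le_rfl⟩, rfl⟩, fun h =>
      (hmono₀ ⟨le_rfl, hε'.le⟩ ⟨hε'.le, le_rfl⟩ hε').ne (by simp only [h])⟩
  set N : Plane →L[ℝ] Plane := LinearMap.toContinuousLinearMap T.symm.linear.toLinearMap with hN
  set N' : Plane →L[ℝ] Plane := LinearMap.toContinuousLinearMap T.linear.toLinearMap with hN'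
  have hNa : ∀ x, T.symm x = N x + T.symm 0 := T.symm.apply_eq_linear_add
  have hN'a : ∀ x, T x = N' x + T 0 := T.apply_eq_linear_add
  have hN'N : ∀ x, N' (N x) = x := fun x => by
    change T.linear (T.symm.linear x) = x
    rw [AffineEquiv.linear_symm]
    simp
  set Y : ℝ → Plane := fun t => T.symm (X t) with hYdef
  have hTY : ∀ t, X t = N' (Y t) + T 0 := fun t => by
    rw [← hN'a, hYdef]; simp
  have hvel : ∀ t, (N.comp (M.comp N')) (Y t) + N (M (T 0) + b) = N (M (X t) + b) := fun t => by
    rw [hTY t]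
    simp only [ContinuousLinearMap.comp_apply, map_add]
    abel
  have hY : ∀ t, HasDerivAt Y ((N.comp (M.comp N')) (Y t) + N (M (T 0) + b)) t := fun t => by
    rw [hvel]
    have h1 := (N.hasFDerivAt.comp_hasDerivAt t (hX t)).add_const (T.symm 0)
    have h2 : Y = fun t => N (X t) + T.symm 0 := funext fun t => hNa _
    rw [h2]
    exact h1
  have hYc : Continuous Y := continuous_iff_continuousAt.2 fun t => (hY t).continuousAt
  set l : Plane →L[ℝ] ℝ := l₀.comp N' with hl
  have hlpos : ∀ t ∈ Icc 0 ε', 0 < l ((N.comp (M.comp N')) (Y t) + N (M (T 0) + b)) :=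
    fun t ht => by
      rw [hvel, hl, ContinuousLinearMap.comp_apply, hN'N]
      exact hpos t ht
  have hmono := strictMonoOn_of_orbit hY hlpos
  have hγY : ∀ y ∈ γ, ∃ t ∈ Icc 0 ε', Y t = y := fun y hy => by
    obtain ⟨t, ht, hty⟩ := hT (mem_image_of_mem T hy)
    exact ⟨t, ht, by rw [hYdef]; simp [hty]⟩
  have hconn : IsConnected (l '' γ) := ⟨nγ.nonempty.image l, cγ.image l l.continuous.continuousOn⟩
  have hIcc := eq_Icc_of_connected_compact hconn (hγ.image l.continuous)
  have hαβ : sInf (l '' γ) ≤ sSup (l '' γ) := by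
    obtain ⟨z, hz⟩ := hconn.nonempty
    rw [hIcc] at hz
    exact hz.1.trans hz.2
  obtain ⟨y₁, hy₁, hα⟩ : sInf (l '' γ) ∈ l '' γ := by
    have := left_mem_Icc.2 hαβ
    rwa [← hIcc] at this
  obtain ⟨y₂, hy₂, hβ⟩ : sSup (l '' γ) ∈ l '' γ := by
    have := right_mem_Icc.2 hαβ
    rwa [← hIcc] at this
  rw [← hα, ← hβ] at hIcc
  obtain ⟨c, hc, rfl⟩ := hγY y₁ hy₁
  obtain ⟨d, hd, rfl⟩ := hγY y₂ hy₂
  have hcdsub : Icc c d ⊆ Icc 0 ε' := Icc_subset_Icc hc.1 hd.2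
  have heq : γ = Y '' Icc c d := by
    ext y
    constructor
    · intro hy
      obtain ⟨t, ht, rfl⟩ := hγY y hy
      have h1 : l (Y t) ∈ Icc (l (Y c)) (l (Y d)) := hIcc ▸ mem_image_of_mem l hy
      exact ⟨t, ⟨(hmono.le_iff_le hc ht).1 h1.1, (hmono.le_iff_le ht hd).1 h1.2⟩, rfl⟩
    · rintro ⟨t, ht, rfl⟩
      have ht' := hcdsub ht
      have h1 : l (Y t) ∈ l '' γ := by
        rw [hIcc]
        exact ⟨(hmono.le_iff_le hc ht').2 ht.1, (hmono.le_iff_le ht' hd).2 ht.2⟩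
      obtain ⟨y, hy, hyt⟩ := h1
      obtain ⟨s, hs, rfl⟩ := hγY y hy
      rwa [← hmono.injOn hs ht' hyt]
  have hcd : c < d := by
    by_contra hcon
    rw [heq] at nγ
    obtain ⟨_, ⟨s, hs, rfl⟩, _, ⟨t, ht, rfl⟩, hst⟩ := nγ
    apply hst
    rw [le_antisymm (hs.2.trans (not_lt.1 hcon)) hs.1, le_antisymm (ht.2.trans (not_lt.1 hcon)) ht.1]
  exact ⟨_, _, Y, l, c, d, hcd, hY, fun t ht => hlpos t (hcdsub ht), heq⟩

/-! ### Affine self-maps of an orbit arc -/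

section SelfMap

variable {M : Plane →L[ℝ] Plane} {b : Plane} {Y : ℝ → Plane} {l : Plane →L[ℝ] ℝ} {c d : ℝ}

-- The time change is `Y⁻¹ ∘ S ∘ Y`, with `S x = L x + q`. The coordinate `l ∘ Y` has positive
-- derivative on the arc, so its local inverse makes `φ` differentiable.
open Filter Topology in
theorem exists_self_time_change (hY : ∀ t, HasDerivAt Y (M (Y t) + b) t)
    (hl : ∀ t ∈ Icc c d, 0 < l (M (Y t) + b)) {L : Plane →L[ℝ] Plane} {q : Plane}
    (hS : ∀ t ∈ Icc c d, L (Y t) + q ∈ Y '' Icc c d) :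
    ∃ φ : ℝ → ℝ, ContinuousOn φ (Icc c d) ∧ (∀ t ∈ Icc c d, φ t ∈ Icc c d) ∧
      (∀ t ∈ Icc c d, Y (φ t) = L (Y t) + q) ∧ ∀ t ∈ Ioo c d, DifferentiableAt ℝ φ t := by
  classical
  have hYc : Continuous Y := continuous_iff_continuousAt.2 fun t => (hY t).continuousAt
  have hmono := strictMonoOn_of_orbit hY hl
  have hex : ∀ t : Icc c d, ∃ s : Icc c d, Y s = L (Y t) + q := fun t => by
    obtain ⟨s, hs, h⟩ := hS t t.2
    exact ⟨⟨s, hs⟩, h⟩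
  choose Φ hΦ using hex
  have hemb : Topology.IsEmbedding fun t : Icc c d => l (Y t) :=
    (Continuous.isClosedEmbedding (by fun_prop)
      fun s t h => Subtype.ext (hmono.injOn s.2 t.2 h)).isEmbedding
  have hΦc : Continuous Φ := by
    rw [hemb.continuous_iff]
    have : ((fun t : Icc c d => l (Y t)) ∘ Φ) = fun t : Icc c d => l (L (Y t) + q) :=
      funext fun t => by simp only [Function.comp_apply, hΦ]
    rw [this]
    fun_prop
  set φ : ℝ → ℝ := fun t => if h : t ∈ Icc c d then Φ ⟨t, h⟩ else c with hφ
  have hφΦ : ∀ t (h : t ∈ Icc c d), φ t = Φ ⟨t, h⟩ := fun t h => by simp only [hφ, dif_pos h]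
  have hφc : ContinuousOn φ (Icc c d) := by
    rw [continuousOn_iff_continuous_domRestrict]
    have : (Icc c d).domRestrict φ = fun t => (Φ t : ℝ) := funext fun t => hφΦ t t.2
    rw [this]
    exact continuous_subtype_val.comp hΦc
  have hφm : ∀ t ∈ Icc c d, φ t ∈ Icc c d := fun t ht => hφΦ t ht ▸ (Φ ⟨t, ht⟩).2
  have hφY : ∀ t ∈ Icc c d, Y (φ t) = L (Y t) + q := fun t ht => by
    rw [hφΦ t ht]
    exact hΦ ⟨t, ht⟩
  refine ⟨φ, hφc, hφm, hφY, fun t ht => ?_⟩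
  have htI := Ioo_subset_Icc_self ht
  have hnhds : Icc c d ∈ 𝓝 t := Icc_mem_nhds ht.1 ht.2
  have hu : ∀ t, HasDerivAt (fun t => l (Y t)) (l (M (Y t) + b)) t := fun t =>
    l.hasFDerivAt.comp_hasDerivAt t (hY t)
  have hstrict : HasStrictDerivAt (fun t => l (Y t)) (l (M (Y (φ t)) + b)) (φ t) :=
    hasStrictDerivAt_of_hasDerivAt_of_continuousAt (Eventually.of_forall hu)
      (Continuous.continuousAt (by fun_prop))
  have hne : l (M (Y (φ t)) + b) ≠ 0 := (hl _ (hφm t htI)).ne'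
  have hinv := hstrict.eventually_left_inverse hne
  have hψ := (hstrict.to_localInverse hne).hasDerivAt.differentiableAt
  set ψ := hstrict.localInverse _ _ _ hne
  have hev : φ =ᶠ[𝓝 t] fun s => ψ (l (L (Y s) + q)) := by
    have hcont : ContinuousAt φ t := hφc.continuousAt hnhds
    filter_upwards [hcont.eventually hinv, hnhds] with s hs hsI
    rw [← hφY s hsI]
    exact hs.symm
  have hd : DifferentiableAt ℝ (fun s => l (L (Y s) + q)) t := by
    have := (hY t).differentiableAt
    fun_prop
  rw [hφY t htI] at hψ
  exact (DifferentiableAt.comp t hψ hd).congr_of_eventuallyEq hev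

theorem isParabolaSegment_of_self_map (hY : ∀ t, HasDerivAt Y (M (Y t) + b) t)
    (hcd : c < d) (hl : ∀ t ∈ Icc c d, 0 < l (M (Y t) + b)) (hflat : ¬ IsFlat (Y '' Icc c d))
    {S : Plane ≃ᵃ[ℝ] Plane} (hS : S '' (Y '' Icc c d) ⊆ Y '' Icc c d)
    (hSne : S '' (Y '' Icc c d) ≠ Y '' Icc c d) : IsParabolaSegment (Y '' Icc c d) := by
  set L : Plane →L[ℝ] Plane := LinearMap.toContinuousLinearMap S.linear.toLinearMap with hLdef
  have hLa : ∀ x, S x = L x + S 0 := S.apply_eq_linear_add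
  have hLinj : ∀ x, L x = 0 → x = 0 := fun x hx => S.linear.map_eq_zero_iff.1 hx
  obtain ⟨φ, hφc, hφm, hφY, hφd⟩ := exists_self_time_change (L := L) (q := S 0) hY hl
    (fun t ht => hLa (Y t) ▸ hS (mem_image_of_mem S (mem_image_of_mem Y ht)))
  have hv0 : ∀ t ∈ Icc c d, M (Y t) + b ≠ 0 := fun t ht h => by
    have := hl t ht
    rw [h, map_zero] at this
    exact lt_irrefl _ this
  have hcross : ∀ t ∈ Icc c d, cross (M (Y t) + b) (M (M (Y t) + b)) ≠ 0 := fun t ht h =>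
    hflat ((isFlat_range_of_cross_eq_zero hY (hv0 t ht) h).mono (image_subset_range _ _))
  have hLv : ∀ t ∈ Ioo c d, L (M (Y t) + b) = deriv φ t • (M (Y (φ t)) + b) := fun t ht => by
    have h1 := (L.hasFDerivAt.comp_hasDerivAt t (hY t)).add_const (S 0)
    have h2 := (hY (φ t)).scomp t (hφd t ht).hasDerivAt
    refine h1.unique (h2.congr_of_eventuallyEq ?_)
    filter_upwards [Icc_mem_nhds ht.1 ht.2] with s hs
    exact (hφY s hs).symm
  -- A formula for `deriv φ` that is visibly differentiable once `φ` is.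
  set ρ : ℝ → ℝ := fun t => l (L (M (Y t) + b)) / l (M (Y (φ t)) + b) with hρdef
  have hρ : ∀ t ∈ Ioo c d, ρ t = deriv φ t := fun t ht => by
    have := (hl _ (hφm t (Ioo_subset_Icc_self ht))).ne'
    rw [hρdef]
    simp only [hLv t ht, map_smul, smul_eq_mul]
    exact mul_div_cancel_right₀ _ this
  obtain ⟨t, ht, hslope⟩ := exists_deriv_eq_slope φ hcd hφc
    fun t ht => (hφd t ht).differentiableWithinAt
  obtain ⟨τ, Δ, hCH, hτ, -⟩ := exists_trace_det (M : Plane →ₗ[ℝ] Plane)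
  simp only [ContinuousLinearMap.coe_coe] at hCH hτ
  -- With equality, `φ` would permute the endpoints and be onto by the intermediate value theorem,
  -- so `S` would map the arc onto itself. The mean value point then has `|φ'| < 1`.
  have hlt : |φ d - φ c| < d - c := by
    have hc := hφm c (left_mem_Icc.2 hcd.le)
    have hd := hφm d (right_mem_Icc.2 hcd.le)
    refine lt_of_le_of_ne (abs_le.2 ⟨by linarith [hc.2, hd.1], by linarith [hc.1, hd.2]⟩) fun h => ?_
    apply hSne
    refine Subset.antisymm hS ?_
    have hsurj : Icc c d ⊆ φ '' Icc c d := by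
      rcases abs_cases (φ d - φ c) with ⟨h1, -⟩ | ⟨h1, -⟩
      · have e1 : φ c = c := by linarith [hc.1, hd.2]
        have e2 : φ d = d := by linarith [hc.1, hd.2]
        have := intermediate_value_Icc hcd.le hφc
        rwa [e1, e2] at this
      · have e1 : φ c = d := by linarith [hc.2, hd.1]
        have e2 : φ d = c := by linarith [hc.2, hd.1]
        have := intermediate_value_Icc' hcd.le hφc
        rwa [e1, e2] at this
    rintro _ ⟨s, hs, rfl⟩
    obtain ⟨t, ht, rfl⟩ := hsurj hs
    rw [hφY t ht, ← hLa]
    exact mem_image_of_mem S (mem_image_of_mem Y ht)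
  have hdet : 9 * Δ = 2 * τ ^ 2 := by
    refine det_eq_of_conj (L := L) (φ := φ) (ρ := ρ) hY hCH hτ isOpen_Ioo (fun t ht => ?_)
      (fun t ht => ?_) (fun t ht => ?_) (fun t ht => ?_)
      (fun t ht => hcross _ (hφm t (Ioo_subset_Icc_self ht))) ht ?_
    · rw [hρ t ht]
      exact (hφd t ht).hasDerivAt
    · rw [hρ t ht]
      intro h
      have := hLv t ht
      rw [h, zero_smul] at this
      exact hv0 t (Ioo_subset_Icc_self ht) (hLinj _ this)
    · have h1 := (hY t).differentiableAt
      have h2 := (hY (φ t)).differentiableAt.comp t (hφd t ht)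
      have h3 : DifferentiableAt ℝ (fun t => l (M (Y (φ t)) + b)) t :=
        l.differentiableAt.comp t ((M.differentiableAt.comp t h2).add_const b)
      have h5 : DifferentiableAt ℝ (fun t => l (L (M (Y t) + b))) t := by fun_prop
      exact h5.div h3 (hl _ (hφm t (Ioo_subset_Icc_self ht))).ne'
    · rw [hρ t ht]
      exact hLv t ht
    · rw [hρ t ht, hslope]
      have h1 : |(φ d - φ c) / (d - c)| < 1 := by
        rw [abs_div, abs_of_pos (sub_pos.2 hcd), div_lt_one (sub_pos.2 hcd)]
        exact hlt
      exact ((sq_lt_one_iff_abs_lt_one _).2 h1).ne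
  refine isParabolaSegment_of_orbit (μ := τ / 3) hY (fun x => ?_) hcd
    (hcross c (left_mem_Icc.2 hcd.le))
  rw [hCH, show 3 * (τ / 3) = τ by ring, show 2 * (τ / 3) ^ 2 = Δ by linarith]

end SelfMap

/-! ### Elementary properties of Jordan arcs -/

theorem IsJordanArcBetween.isPreconnected {γ : Set Plane} {x y : Plane}
    (h : IsJordanArcBetween γ x y) : IsPreconnected γ := by
  obtain ⟨p, -, rfl⟩ := h
  exact isPreconnected_range p.continuous

theorem IsJordanArcBetween.isCompact {γ : Set Plane} {x y : Plane}
    (h : IsJordanArcBetween γ x y) : IsCompact γ := by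
  obtain ⟨p, -, rfl⟩ := h
  exact isCompact_range p.continuous

theorem IsJordanArcBetween.left_mem {γ : Set Plane} {x y : Plane}
    (h : IsJordanArcBetween γ x y) : x ∈ γ := by
  obtain ⟨p, -, rfl⟩ := h
  exact ⟨0, p.source⟩

theorem IsJordanArcBetween.right_mem {γ : Set Plane} {x y : Plane}
    (h : IsJordanArcBetween γ x y) : y ∈ γ := by
  obtain ⟨p, -, rfl⟩ := h
  exact ⟨1, p.target⟩

theorem IsJordanArcBetween.nontrivial {γ : Set Plane} {x y : Plane}
    (h : IsJordanArcBetween γ x y) : γ.Nontrivial := by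
  refine ⟨x, h.left_mem, y, h.right_mem, ?_⟩
  obtain ⟨p, hp, -⟩ := h
  exact fun h => zero_ne_one (hp (p.source.trans (h.trans p.target.symm)))

/-! ### Near-identity maps from infinitely many subarcs -/

section Attractor

variable {m : ℕ} {S : Fin m → Plane ≃ᵃ[ℝ] Plane} {K : NNReal} {γ : Set Plane}

theorem isFlat_of_subset (hS : γ = ⋃ i, S i '' γ) (hK : ∀ i, LipschitzWith K (S i))
    (hK1 : K < 1) (harc : IsJordanArc γ) (hγ : IsCompact γ) {D : Set Plane} (hD : D ⊆ γ)
    (cD : IsPreconnected D) (nD : D.Nontrivial) (hflat : IsFlat D) : IsFlat γ := by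
  obtain ⟨T, r, -, hT, -⟩ := exists_piece_subset hS hK hK1 harc hγ hD cD nD
  exact (hflat.mono hT).of_image T

/-- The given map may send only a tiny part of `γ` onto `α`, so such maps need not be bounded.
Precomposing with a piece comparable to the preimage of `α` leaves `h(γ) ∩ γ` unchanged and places
one of the finitely many sets `S i (γ)` inside that preimage. A degenerate map would make `α`, hence
`γ`, flat. -/
theorem exists_normalized_map (hS : γ = ⋃ i, S i '' γ) (hK : ∀ i, LipschitzWith K (S i))
    (hK1 : K < 1) (harc : IsJordanArc γ) (hflat : ¬ IsFlat γ) {δ : ℝ} {α : Set Plane}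
    (hα : α ∈ properSubarcs γ δ) :
    ∃ (h : Plane ≃ᵃ[ℝ] Plane) (i : Fin m) (y : Plane), NestedAt γ y ∧ y ∈ α ∧
      α = h '' γ ∩ γ ∧ IsPreconnected α ∧ h '' (S i '' γ) ⊆ α ∧ δ ≤ Metric.diam α := by
  have hγ : IsCompact γ := by
    obtain ⟨a, b, h⟩ := harc
    exact h.isCompact
  have cγ : IsPreconnected γ := by
    obtain ⟨a, b, h⟩ := harc
    exact h.isPreconnected
  obtain ⟨h, ⟨x, y, hxy, hx, hy⟩, hαeq, hδ⟩ := hα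
  rw [← hαeq] at hxy
  have hαγ : α ⊆ γ := hαeq ▸ inter_subset_right
  have hαh : α ⊆ h '' γ := hαeq ▸ inter_subset_left
  have hb : Function.Bijective h := by
    by_contra hb
    exact hflat (isFlat_of_subset hS hK hK1 harc hγ hαγ hxy.isPreconnected hxy.nontrivial
      ((IsFlat.image_of_not_bijective hb γ).mono hαh))
  set e : Plane ≃ᵃ[ℝ] Plane := AffineEquiv.ofBijective hb with he
  have heh : ∀ z, e z = h z := fun z => rfl
  have hee : e '' γ = h '' γ := rfl
  have hβ : e.symm '' α ⊆ γ := by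
    rintro _ ⟨z, hz, rfl⟩
    obtain ⟨u, hu, rfl⟩ := hαh hz
    rw [← heh, AffineEquiv.symm_apply_apply]
    exact hu
  have hec : Continuous e.symm := (e.symm : Plane →ᵃ[ℝ] Plane).continuous_of_finiteDimensional
  have hnest : NestedAt γ (e.symm x) := by
    refine NestedAt.of_image e ?_
    rw [AffineEquiv.apply_symm_apply]
    exact hx.nestedAt
  obtain ⟨T, i, h1, h2, h3⟩ := exists_piece_comparable hS hK hK1 hγ cγ hβ
    (hxy.isPreconnected.image _ hec.continuousOn)
    (Metric.diam_pos (hxy.nontrivial.image e.symm.injective) (hγ.isBounded.subset hβ))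
    (mem_image_of_mem _ hxy.left_mem) hnest
  have hαT : α ⊆ T.trans e '' γ := fun z hz => by
    obtain ⟨u, hu, huz⟩ := h2 (mem_image_of_mem _ hz)
    refine ⟨u, hu, ?_⟩
    change e (T u) = z
    rw [huz, AffineEquiv.apply_symm_apply]
  refine ⟨T.trans e, i, y, hy.nestedAt, hxy.right_mem, ?_, hxy.isPreconnected, ?_, hδ⟩
  · refine Subset.antisymm (subset_inter hαT hαγ) ?_
    rintro z ⟨⟨u, hu, rfl⟩, hz⟩
    rw [hαeq]
    exact ⟨⟨T u, h1 (mem_image_of_mem T hu), rfl⟩, hz⟩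
  · rintro _ ⟨u, hu, rfl⟩
    obtain ⟨z, hz, hzu⟩ := h3 (mem_image_of_mem T hu)
    change e (T u) ∈ α
    rw [← hzu, AffineEquiv.apply_symm_apply]
    exact hz

theorem norm_homog_le_of_mapsTo {W : Set Plane} (hWne : W.Nonempty) (hW : ¬ IsFlat W)
    (hγ : Bornology.IsBounded γ) : ∃ R : ℝ, 0 < R ∧ ∀ f : Plane →ᵃ[ℝ] Plane,
      (∀ z ∈ W, f z ∈ γ) → ‖homog f‖ ≤ R := by
  obtain ⟨C, hC, hC'⟩ := exists_norm_le_of_not_isFlat hWne hW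
  obtain ⟨B, hB⟩ := hγ.exists_norm_le
  refine ⟨C * max B 1, by positivity, fun f hf => hC' _ _ (by positivity) fun x hx => ?_⟩
  rw [homog_apply_one, Prod.norm_def]
  simp only [norm_one]
  exact max_le_max (hB _ (hf x hx)) le_rfl

theorem exists_near_identity (hS : γ = ⋃ i, S i '' γ) (hK : ∀ i, LipschitzWith K (S i))
    (hK1 : K < 1) (harc : IsJordanArc γ) (hflat : ¬ IsFlat γ) {δ : ℝ} (hδ : 0 < δ)
    (hinf : (properSubarcs γ δ).Infinite) :
    ∃ i : Fin m, ∀ ε : ℝ, 0 < ε → ∃ f : Plane →ᵃ[ℝ] Plane,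
      homog f ≠ 1 ∧ ‖homog f - 1‖ < ε ∧ ∀ z ∈ S i '' γ, f z ∈ γ := by
  have hnorm := fun α : properSubarcs γ δ =>
    exists_normalized_map hS hK hK1 harc hflat α.2
  choose h i y hnest hyα hα cα hiα hδα using hnorm
  obtain ⟨a, b, hab⟩ := id harc
  have hγ := hab.isCompact
  have hne : γ.Nonempty := ⟨a, hab.left_mem⟩
  have hαγ : ∀ α : properSubarcs γ δ, (α : Set Plane) ⊆ γ := fun α =>
    (hα α).subset.trans inter_subset_right
  have hyab : ∀ α, y α = a ∨ y α = b := fun α => by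
    obtain ⟨p, hp, hpγ⟩ := hab
    exact NestedAt.eq_or_eq hp (hpγ ▸ hnest α) (hpγ ▸ hαγ α (hyα α))
  have : Infinite (properSubarcs γ δ) := hinf.to_subtype
  -- The proposition `y α = a` records which of the two endpoints of `γ` the arc contains as `y α`.
  obtain ⟨⟨j, P⟩, hfib⟩ := Finite.exists_infinite_fiber
    (fun α : properSubarcs γ δ => ((i α, y α = a) : Fin m × Prop))
  set s := (fun α : properSubarcs γ δ => ((i α, y α = a) : Fin m × Prop)) ⁻¹' {(j, P)} with hs
  have hsi : ∀ α ∈ s, i α = j := fun α hα => congrArg Prod.fst hα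
  obtain ⟨q, hq⟩ : ∃ q, ∀ α ∈ s, y α = q := by
    by_cases hP : P
    · exact ⟨a, fun α hα => (congrArg Prod.snd hα).mpr hP⟩
    · exact ⟨b, fun α hα => (hyab α).resolve_left fun h => hP ((congrArg Prod.snd hα).mp h)⟩
  have hsinf : s.Infinite := infinite_coe_iff.1 hfib
  obtain ⟨α₀, hα₀⟩ := hsinf.nonempty
  have hqγ : q ∈ γ := hq α₀ hα₀ ▸ hαγ α₀ (hyα α₀)
  have hqn : NestedAt γ q := hq α₀ hα₀ ▸ hnest α₀
  -- A piece at `q` of diameter below `δ` lies in every selected arc. All inverses send it into `γ`,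
  -- which bounds them uniformly.
  obtain ⟨T, hT1, hT2, hT3⟩ := exists_small_piece hS hK hK1 hγ hqγ hδ
  have hTα : ∀ α ∈ s, T '' γ ⊆ α := fun α hαs => by
    have hc : IsPreconnected (T '' γ) := hab.isPreconnected.image _
      (T : Plane →ᵃ[ℝ] Plane).continuous_of_finiteDimensional.continuousOn
    refine (hqn _ _ hT1 (hαγ α) hc (cα α) hT2 (hq α hαs ▸ hyα α)).resolve_right fun hle => ?_
    have := Metric.diam_mono hle (hγ.isBounded.subset hT1)
    linarith [hδα α]
  obtain ⟨R, -, hR⟩ := norm_homog_le_of_mapsTo (hne.image (S j))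
    (fun hf => hflat (hf.of_image (S j))) hγ.isBounded
  obtain ⟨R', hR'0, hR'⟩ := norm_homog_le_of_mapsTo (hne.image T)
    (fun hf => hflat (hf.of_image T)) hγ.isBounded
  have hsymm : ∀ α ∈ s, ‖homog ((h α).symm : Plane →ᵃ[ℝ] Plane)‖ ≤ R' := fun α hαs => by
    refine hR' _ fun z hz => ?_
    have hz' := hTα α hαs hz
    rw [hα α] at hz'
    obtain ⟨u, hu, huz⟩ := hz'.1
    rw [← huz]
    simpa using hu
  refine ⟨j, fun ε hε => ?_⟩
  have key : ∀ α₁ ∈ s, ∀ α₂ ∈ s, α₁ ≠ α₂ → (α₁ : Set Plane) ⊆ α₂ →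
      ‖homog (h α₁ : Plane →ᵃ[ℝ] Plane) - homog (h α₂ : Plane →ᵃ[ℝ] Plane)‖ < ε / R' →
      ∃ f : Plane →ᵃ[ℝ] Plane,
        homog f ≠ 1 ∧ ‖homog f - 1‖ < ε ∧ ∀ z ∈ S j '' γ, f z ∈ γ := by
    intro α₁ h₁ α₂ h₂ hne hle hlt
    have hinv : homog ((h α₂).symm : Plane →ᵃ[ℝ] Plane) *
        homog (h α₂ : Plane →ᵃ[ℝ] Plane) = 1 := by
      rw [← homog_comp, ← homog_id]
      congr 1
      ext1 z
      simp
    have hinv' : homog (h α₂ : Plane →ᵃ[ℝ] Plane) *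
        homog ((h α₂).symm : Plane →ᵃ[ℝ] Plane) = 1 := by
      rw [← homog_comp, ← homog_id]
      congr 1
      ext1 z
      simp
    refine ⟨((h α₂).symm : Plane →ᵃ[ℝ] Plane).comp (h α₁ : Plane →ᵃ[ℝ] Plane), ?_, ?_, ?_⟩
    · rw [homog_comp]
      intro h1
      have h2 : homog (h α₁ : Plane →ᵃ[ℝ] Plane) = homog (h α₂ : Plane →ᵃ[ℝ] Plane) := by
        rw [← one_mul (homog (h α₁ : Plane →ᵃ[ℝ] Plane)), ← hinv', mul_assoc, h1, mul_one]
      have h3 := homog_injective h2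
      have h4 : ∀ z, h α₁ z = h α₂ z := fun z => DFunLike.congr_fun h3 z
      apply hne
      apply Subtype.ext
      rw [hα α₁, hα α₂]
      congr 1
      exact image_congr fun z _ => h4 z
    · rw [homog_comp, ← hinv, ← mul_sub]
      calc _ ≤ ‖homog ((h α₂).symm : Plane →ᵃ[ℝ] Plane)‖ *
            ‖homog (h α₁ : Plane →ᵃ[ℝ] Plane) - homog (h α₂ : Plane →ᵃ[ℝ] Plane)‖ :=
            norm_mul_le _ _
        _ ≤ R' * ‖homog (h α₁ : Plane →ᵃ[ℝ] Plane) - homog (h α₂ : Plane →ᵃ[ℝ] Plane)‖ := by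
            gcongr
            exact hsymm α₂ h₂
        _ < R' * (ε / R') := by gcongr
        _ = ε := mul_div_cancel₀ ε hR'0.ne'
    · intro z hz
      have h1 : h α₁ z ∈ (α₂ : Set Plane) :=
        hle (hiα α₁ ⟨z, by rwa [hsi α₁ h₁], rfl⟩)
      rw [hα α₂] at h1
      obtain ⟨u, hu, huz⟩ := h1.1
      change (h α₂).symm (h α₁ z) ∈ γ
      rw [← huz, AffineEquiv.symm_apply_apply]
      exact hu
  obtain ⟨α₁, h₁, α₂, h₂, hne, hlt⟩ := exists_close_pair hsinf
    (f := fun α => homog (h α : Plane →ᵃ[ℝ] Plane)) (R := R)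
    (fun α hαs => hR _ fun z hz => hαγ α (hiα α ⟨z, by rwa [hsi α hαs], rfl⟩))
    (div_pos hε hR'0)
  rcases hqn _ _ (hαγ α₁) (hαγ α₂) (cα α₁) (cα α₂) (hq α₁ h₁ ▸ hyα α₁) (hq α₂ h₂ ▸ hyα α₂)
    with hle | hle
  · exact key α₁ h₁ α₂ h₂ hne hle hlt
  · exact key α₂ h₂ α₁ h₁ hne.symm hle (by rwa [norm_sub_rev])

theorem isParabolaSegment_of_infinite (hS : γ = ⋃ i, S i '' γ)
    (hK : ∀ i, LipschitzWith K (S i)) (hK1 : K < 1) (harc : IsJordanArc γ)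
    (hflat : ¬ IsFlat γ) {δ : ℝ} (hδ : 0 < δ) (hinf : (properSubarcs γ δ).Infinite) :
    IsParabolaSegment γ := by
  obtain ⟨j, hj⟩ := exists_near_identity hS hK hK1 harc hflat hδ hinf
  obtain ⟨a, b, hab⟩ := id harc
  have hγ := hab.isCompact
  have hsub : S j '' γ ⊆ γ := by
    conv_rhs => rw [hS]
    exact subset_iUnion (fun i => S i '' γ) j
  have hpiece : ∀ D ⊆ γ, IsPreconnected D → D.Nontrivial →
      ∃ T : Plane ≃ᵃ[ℝ] Plane, T '' γ ⊆ D := fun D hD cD nD => by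
    obtain ⟨T, _, -, hT, -⟩ := exists_piece_subset hS hK hK1 harc hγ hD cD nD
    exact ⟨T, hT⟩
  obtain ⟨T, r, hr, -, hTγ, hTD⟩ := exists_piece_subset hS hK hK1 harc hγ hsub
    (hab.isPreconnected.image _ (hK j).continuous.continuousOn)
    (hab.nontrivial.image (S j).injective)
  obtain ⟨M, v, X, ε, hε, hX, hne, hXγ⟩ := exists_orbit_subset hγ.isClosed hTγ
    (hab.nontrivial.nonempty.image T) (fun h => hflat (h.of_image T)) hr hTD hj
  obtain ⟨M', v', Y, l, c, d, hcd, hY, hl, rfl⟩ := exists_orbit_param hγ hab.isPreconnected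
    hab.nontrivial hpiece hε hX hne hXγ
  -- A contraction strictly shrinks the positive diameter, so `S j` cannot map `γ` onto itself.
  refine isParabolaSegment_of_self_map hY hcd hl hflat hsub fun heq => ?_
  have h1 := diam_image_le hγ (hK j)
  rw [heq] at h1
  have h2 := Metric.diam_pos hab.nontrivial hγ.isBounded
  have h3 : (K : ℝ) < 1 := by exact_mod_cast hK1
  nlinarith

end Attractor

theorem mainTheorem3 {m : ℕ} (S : Fin m → Plane →ᵃ[ℝ] Plane)
    (hcontr : ∀ i, ∃ K : NNReal, K < 1 ∧ LipschitzWith K (S i))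
    (hnondeg : ∀ i, Function.Bijective (S i))
    (γ : Set Plane) (hγ : IsAttractor S γ) (harc : IsJordanArc γ)
    (δ : ℝ) (hδ : 0 < δ) (hinf : (properSubarcs γ δ).Infinite) :
    IsParabolaSegment γ ∨ IsStraightSegment γ := by
  choose k hk1 hk using hcontr
  by_cases hflat : IsFlat γ
  · right
    obtain ⟨a, b, hab⟩ := harc
    exact isStraightSegment_of_isFlat hflat hab.isCompact hab.isPreconnected hab.nontrivial
  · left
    refine isParabolaSegment_of_infinite (S := fun i => AffineEquiv.ofBijective (hnondeg i))
      (K := Finset.univ.sup k) hγ.2.2 (fun i => ?_) ?_ harc hflat hδ hinf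
    · exact (hk i).weaken (Finset.le_sup (Finset.mem_univ i))
    · exact (Finset.sup_lt_iff (by simp)).2 fun i _ => hk1 i
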